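/- Let $X$ be a connected, finite, simple $3$-valent plane graph; the counterclockwise cyclic order of the edges at each vertex orients $X$ at its vertices. Put $\omega=e^{\pi i/3}$. For $(k,l)\in\mathbb Z^2\setminus\{(0,0)\}$ and $z=k+l\omega$, the Goldberg--Coxeter construction $\mathrm{GC}_{k,l}(X)$ is the following $3$-valent graph. Take for every vertex $p$ of $X$ a copy of the triangle $\triangle(0,z,\omega z)$, together with all unit triangles of the lattice $\mathbb Z[\omega]$ that meet its interior, the three edges at $p$ corresponding, in counterclockwise order, to the three sides. For each edge $pq$ of $X$ place the copy of $p$ on $\triangle(0,z,\omega z)$ and that of $q$ on the adjacent triangle $\triangle(z,(1+\omega)z,\omega z)$, so that $pq$ corresponds to the common side, and identify the unit triangles of the two copies that coincide. The vertices of $\mathrm{GC}_{k,l}(X)$ are the resulting unit triangles, and two of them are adjacent if, in one of these placements, they share an edge. Consider the following conditions on a colouring of the vertices of $X$ in black and white: * (C-i) every black vertex is adjacent to three white vertices; * (C-ii) every white vertex is adjacent to exactly one black vertex; * (C-iii) for any two black vertices $x,y$ at distance three there is a path of length three from $x$ to $y$ which turns left at both of its inner vertices or turns right at both of them. Eigenvalues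 are those of the Laplacian $(\Delta f)(p)=\deg(p)f(p)-\sum_{q\sim p}f(q)$ on complex functions on the vertices. 1. If $X$ has a colouring satisfying (C-i) and (C-ii), then for every integer $s\ge 1$ the graph $\mathrm{GC}_{2s-1,0}(X)$ has eigenvalue $4$. 2. If $X$ has a colouring satisfying (C-i), (C-ii) and (C-iii), then for every integer $k\ge 1$ both $\mathrm{GC}_{k,0}(X)$ and $\mathrm{GC}_{k,k}(X)$ have eigenvalue $4$ with multiplicity at least $\lceil k/2\rceil$ and eigenvalue $2$ with multiplicity at least $\lfloor k/2\rfloor$ (no assertion about the eigenvalue $2$ being intended when $\lfloor k/2\rfloor=0$). -/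

import Mathlib

/-! ### Plane graphs as rotation systems -/

/-- An orientation at each vertex of a graph: `next d` is the dart that follows `d` in the
counterclockwise cyclic order of the darts (oriented edges) emanating from the vertex `d.fst`. -/
structure RotationSystem {V : Type*} (X : SimpleGraph V) where
  /-- the counterclockwise successor of a dart around its initial vertex -/
  next : Equiv.Perm X.Dart
  fst_next : ∀ d, (next d).fst = d.fst
  sameCycle_of_fst_eq : ∀ d d' : X.Dart, d.fst = d'.fst → next.SameCycle d d'

namespace RotationSystem

variable {V : Type*} {X : SimpleGraph V}

/-- The involution reversing every dart. -/
def reverse (X : SimpleGraph V) : Equiv.Perm X.Dart where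
  toFun d := d.symm
  invFun d := d.symm
  left_inv d := d.symm_symm
  right_inv d := d.symm_symm

/-- Traverse the dart `d` and, at its terminal vertex, take the leftmost edge. -/
def turnLeft (R : RotationSystem X) : Equiv.Perm X.Dart := R.next⁻¹ * reverse X

/-- Traverse the dart `d` and, at its terminal vertex, take the rightmost edge. -/
def turnRight (R : RotationSystem X) : Equiv.Perm X.Dart := R.next * reverse X

/-- The faces: a face is the cyclic sequence of darts having it on their left-hand side. -/
def Face (R : RotationSystem X) : Type _ := Quotient (Equiv.Perm.SameCycle.setoid R.turnLeft)

/-- A rotation system on a connected finite graph is plane if the surface obtained by gluing a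
disc along every face is the sphere, i.e. its Euler characteristic `V - E + F` is `2`. -/
def IsPlane (R : RotationSystem X) : Prop :=
  (Nat.card V : ℤ) - Nat.card X.edgeSet + Nat.card R.Face = 2

end RotationSystem

/-! ### Small triangles of the triangular lattice

The Eisenstein integer `a + b ω`, `ω = exp (π i / 3)`, is written `(a, b) : ℤ × ℤ`, and points of
the plane are written likewise in the positively oriented real basis `(1, ω)` of `ℂ`. -/

/-- The unit triangles of the lattice `ℤ[ω]`. -/
inductive SmallTriangle where
  /-- the upward triangle with vertices `a + b ω`, `a + 1 + b ω`, `a + (b + 1) ω` -/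
  | up (a b : ℤ) : SmallTriangle
  /-- the downward triangle with vertices `a + b ω`, `a + (b + 1) ω`, `a - 1 + (b + 1) ω` -/
  | down (a b : ℤ) : SmallTriangle

namespace Eisenstein

/-- Multiplication by `ω`, using `ω ^ 2 = ω - 1`. -/
def mulOmega (w : ℤ × ℤ) : ℤ × ℤ := (-w.2, w.1 + w.2)

/-- A lattice point as a point of the plane. -/
def toPlane (w : ℤ × ℤ) : ℝ × ℝ := ((w.1 : ℝ), (w.2 : ℝ))

/-- The interior of the triangle with vertices `0`, `z`, `ω z`. -/
def openTriangle (z : ℤ × ℤ) : Set (ℝ × ℝ) :=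
  {x | ∃ s t : ℝ, 0 < s ∧ 0 < t ∧ s + t < 1 ∧ x = s • toPlane z + t • toPlane (mulOmega z)}

/-- The rotation by `-2π/3` of the triangle `0, z, ω z` about its centre. It moves the side from
`ω z` to `0`, which follows the side from `z` to `ω z` counterclockwise, onto the latter. -/
def rotate (z w : ℤ × ℤ) : ℤ × ℤ := mulOmega (z - w)

/-- The rotation by `π` about the midpoint of the side from `z` to `ω z`. It exchanges the triangle
`0, z, ω z` with the triangle `(1 + ω) z, ω z, z` on the other side of that side. -/
def flip (z w : ℤ × ℤ) : ℤ × ℤ := z + mulOmega z - w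

end Eisenstein

namespace SmallTriangle

open Eisenstein

/-- The three vertices of a small triangle. -/
def vertices : SmallTriangle → Finset (ℤ × ℤ)
  | up a b => {(a, b), (a + 1, b), (a, b + 1)}
  | down a b => {(a, b), (a, b + 1), (a - 1, b + 1)}

/-- The small triangle as a closed subset of the plane. -/
def solid (t : SmallTriangle) : Set (ℝ × ℝ) := convexHull ℝ (toPlane '' (t.vertices : Set (ℤ × ℤ)))

/-- The small triangle intersects the interior of the triangle `0, z, ω z`. -/
def Meets (z : ℤ × ℤ) (t : SmallTriangle) : Prop := (t.solid ∩ openTriangle z).Nonempty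

end SmallTriangle

/-- Two unit triangles, given by their vertices, are neighbours if they have exactly one edge in
common. -/
def ShareEdge (T T' : Finset (ℤ × ℤ)) : Prop := (T ∩ T').card = 2

/-! ### The Goldberg–Coxeter construction for 3-valent graphs -/

namespace GoldbergCoxeter

open Eisenstein

variable {V : Type*} {X : SimpleGraph V}

/-- The small triangles intersecting the interior of the triangle `0, z, ω z`. -/
abbrev Cell (z : ℤ × ℤ) : Type := {t : SmallTriangle // t.Meets z}

/-- `(d, t)` stands for the small triangle `t` in the copy of the triangle `0, z, ω z` that belongs
to the vertex `d.fst`, placed so that the edge of `d` corresponds to the side from `z` to `ω z`. -/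
abbrev PlacedCell (X : SimpleGraph V) (z : ℤ × ℤ) : Type _ := X.Dart × Cell z

/-- The identifications of placed cells. -/
inductive Glue (R : RotationSystem X) (z : ℤ × ℤ) : PlacedCell X z → PlacedCell X z → Prop
  /-- the same small triangle of the copy of one vertex, seen from the placements of that copy
  with respect to two consecutive darts -/
  | turn (d : X.Dart) (t t' : Cell z) (h : t'.1.vertices = t.1.vertices.image (rotate z)) :
      Glue R z (d, t) (R.next d, t')
  /-- overlapping small triangles of the copies of two adjacent vertices, the second copy being
  placed on the triangle `(1 + ω) z, ω z, z` -/
  | cross (d : X.Dart) (t t' : Cell z) (h : t'.1.vertices = t.1.vertices.image (flip z)) :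
      Glue R z (d, t) (d.symm, t')

/-- The vertices of the Goldberg–Coxeter construction: placed cells modulo the equivalence relation
generated by the identifications. -/
def Vertex (R : RotationSystem X) (z : ℤ × ℤ) : Type _ := Quot (Glue R z)

/-- The vertex of the Goldberg–Coxeter construction represented by a placed cell. -/
def vertexMk (R : RotationSystem X) (z : ℤ × ℤ) (d : X.Dart) (t : Cell z) : Vertex R z :=
  Quot.mk _ (d, t)

/-- Neighbouring small triangles, either in the copy of one vertex or in the copies of two adjacent
vertices laid out side by side on `0, z, ω z` and `(1 + ω) z, ω z, z`. -/
inductive Neighbour (R : RotationSystem X) (z : ℤ × ℤ) : Vertex R z → Vertex R z → Prop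
  | inside (d : X.Dart) (t t' : Cell z) (h : ShareEdge t.1.vertices t'.1.vertices) :
      Neighbour R z (vertexMk R z d t) (vertexMk R z d t')
  | across (d : X.Dart) (t t' : Cell z)
      (h : ShareEdge t.1.vertices (t'.1.vertices.image (flip z))) :
      Neighbour R z (vertexMk R z d t) (vertexMk R z d.symm t')

/-- The Goldberg–Coxeter construction `GC_{k,l}(X)` of a 3-valent graph `X` with an orientation at
each vertex. -/
def graph (R : RotationSystem X) (k l : ℤ) : SimpleGraph (Vertex R (k, l)) :=
  SimpleGraph.fromRel (Neighbour R (k, l))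

theorem finite_cell (z : ℤ × ℤ) : Finite (Cell z) := by
  obtain ⟨k, l⟩ := z
  let M : ℤ := |k| + |l| + 2
  have key : ∀ (a b : ℤ) (S : Set (ℤ × ℤ)),
      (∀ w ∈ S, (a - 1 ≤ w.1 ∧ w.1 ≤ a + 1) ∧ (b - 1 ≤ w.2 ∧ w.2 ≤ b + 1)) →
      (convexHull ℝ (toPlane '' S) ∩ openTriangle (k, l)).Nonempty →
      a ∈ Set.Icc (-M) M ∧ b ∈ Set.Icc (-(2 * M)) (2 * M) := by
    rintro a b S hS ⟨x, hx, s, t, hs, ht, hst, rfl⟩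
    have hsub : convexHull ℝ (toPlane '' S) ⊆
        Set.Icc ((a : ℝ) - 1) (a + 1) ×ˢ Set.Icc ((b : ℝ) - 1) (b + 1) := by
      refine convexHull_min ?_ ((convex_Icc _ _).prod (convex_Icc _ _))
      rintro _ ⟨w, hw, rfl⟩
      obtain ⟨⟨h1, h2⟩, h3, h4⟩ := hS w hw
      simp only [toPlane, Set.mem_prod, Set.mem_Icc]
      exact ⟨⟨by exact_mod_cast h1, by exact_mod_cast h2⟩, by exact_mod_cast h3,
        by exact_mod_cast h4⟩
    obtain ⟨⟨h1, h2⟩, h3, h4⟩ := hsub hx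
    simp only [toPlane, mulOmega, Prod.smul_mk, Prod.mk_add_mk, smul_eq_mul, Int.cast_neg,
      Int.cast_add] at h1 h2 h3 h4
    have bd : ∀ (c y : ℝ), 0 < c → c < 1 → |c * y| ≤ |y| := by
      intro c y h0 h1
      rw [abs_mul, abs_of_pos h0]
      exact mul_le_of_le_one_left (abs_nonneg y) h1.le
    have e1 := abs_le.1 (bd s k hs (by linarith))
    have e2 := abs_le.1 (bd t l ht (by linarith))
    have e3 := abs_le.1 (bd s l hs (by linarith))
    have e4 := abs_le.1 (bd t k ht (by linarith))
    have p1 := abs_nonneg (k : ℝ)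
    have p2 := abs_nonneg (l : ℝ)
    have r1 : (-M : ℝ) ≤ a := by simp only [M]; push_cast; linarith
    have r2 : (a : ℝ) ≤ M := by simp only [M]; push_cast; linarith
    have r3 : (-(2 * M) : ℝ) ≤ b := by simp only [M]; push_cast; linarith
    have r4 : (b : ℝ) ≤ 2 * M := by simp only [M]; push_cast; linarith
    exact ⟨⟨by exact_mod_cast r1, by exact_mod_cast r2⟩, by exact_mod_cast r3,
      by exact_mod_cast r4⟩
  have hfin : (Set.Icc (-M) M ×ˢ Set.Icc (-(2 * M)) (2 * M)).Finite :=
    (Set.finite_Icc _ _).prod (Set.finite_Icc _ _)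
  refine Set.Finite.to_subtype (((hfin.image fun p => SmallTriangle.up p.1 p.2).union
    (hfin.image fun p => SmallTriangle.down p.1 p.2)).subset ?_)
  rintro (⟨a, b⟩ | ⟨a, b⟩) h
  · refine Or.inl ⟨(a, b), key a b _ ?_ h, rfl⟩
    intro w hw
    simp only [SmallTriangle.vertices, Finset.coe_insert, Finset.coe_singleton,
      Set.mem_insert_iff, Set.mem_singleton_iff] at hw
    rcases hw with rfl | rfl | rfl <;> refine ⟨⟨?_, ?_⟩, ?_, ?_⟩ <;> dsimp only <;> omega
  · refine Or.inr ⟨(a, b), key a b _ ?_ h, rfl⟩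
    intro w hw
    simp only [SmallTriangle.vertices, Finset.coe_insert, Finset.coe_singleton,
      Set.mem_insert_iff, Set.mem_singleton_iff] at hw
    rcases hw with rfl | rfl | rfl <;> refine ⟨⟨?_, ?_⟩, ?_, ?_⟩ <;> dsimp only <;> omega

instance finite_vertex [Finite V] (R : RotationSystem X) (z : ℤ × ℤ) : Finite (Vertex R z) := by
  have := finite_cell z
  have : Finite X.Dart := Finite.of_injective _ SimpleGraph.Dart.toProd_injective
  exact Quot.finite _

end GoldbergCoxeter

/-! ### Laplacian -/

open Classical in
/-- The Laplacian `(Δ f)(p) = deg(p) f(p) - ∑ f(q)`, summed over the neighbours `q` of `p`, acting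
on complex functions on the vertices of a finite graph. -/
noncomputable def graphLaplacian {W : Type*} [Finite W] (H : SimpleGraph W) :
    Module.End ℂ (W → ℂ) :=
  letI := Fintype.ofFinite W
  Matrix.toLin' (H.lapMatrix ℂ)

/-- The multiplicity of `c` as an eigenvalue of the (symmetric) Laplacian; `0` if it is none. -/
noncomputable def eigenvalueMultiplicity {W : Type*} [Finite W] (H : SimpleGraph W) (c : ℂ) : ℕ :=
  Module.finrank ℂ (Module.End.eigenspace (graphLaplacian H) c)

/-! ### Black and white colourings: `B` is the set of black vertices, the others are white. -/

/-- Every neighbour of a black vertex is white. -/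
def CondCi {V : Type*} (X : SimpleGraph V) (B : Set V) : Prop :=
  ∀ p ∈ B, ∀ q, X.Adj p q → q ∉ B

/-- Every white vertex is adjacent to exactly one black vertex. -/
def CondCii {V : Type*} (X : SimpleGraph V) (B : Set V) : Prop :=
  ∀ p ∉ B, ∃! q, X.Adj p q ∧ q ∈ B

/-- For any two black vertices `x`, `y` at distance three there is a path of length three from `x`
to `y` which turns left twice or turns right twice. -/
def CondCiii {V : Type*} {X : SimpleGraph V} (R : RotationSystem X) (B : Set V) : Prop :=
  ∀ x ∈ B, ∀ y ∈ B, X.dist x y = 3 →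
    ∃ d : X.Dart, d.fst = x ∧
      ((R.turnLeft (R.turnLeft d)).snd = y ∨ (R.turnRight (R.turnRight d)).snd = y)

/-! All eigenfunctions are built in the plane. A function of a dart and a small triangle that
respects the two gluing rules (`Compatible`) descends to the Goldberg–Coxeter graph. There the
neighbours of a vertex are its three neighbours in the plane, so a function whose sum over planar
neighbours is μ times its value has Laplace eigenvalue 3 - μ (`Compatible.graphLaplacian_lift`).
That the planar picture is faithful near every cell is needed only for z = (k, 0) and z = (k, k),
and follows from the incidences in `CellGeometry`.

Part 1. By (C-i) and (C-ii) every closed neighbourhood in X has exactly one black vertex, so f = 3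
on black, -1 on white has sum zero over closed neighbourhoods. A 2-periodic pattern puts the four
values of a closed neighbourhood on every small triangle and its three neighbours, giving μ = -1;
for odd k the patterns of adjacent copies match.

Part 2. A black vertex and its three white neighbours fill the triangle 0, 2z, 2ωz, the black one in
the middle. For σ = ±1 the function `wave σ g` has μ = -σ, hence eigenvalue 3 + σ. If g(-n) = σ g(n)
and g is 2k-periodic, the wave is invariant under the rotation by π/3 about 0 and the translation by
2z, and so fits all gluings of these large triangles, provided that adjacent white vertices are
glued corner to corner: the edges to their black neighbours must leave on the same side of the
common edge. This is `CondCiii.white_edge`, where planarity enters. White–white edges form disjoint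
cycles, so the faces have a two-colouring that changes exactly across them. The faces around a black
vertex share a colour. Black neighbours of adjacent white vertices are equal or, by (C-iii), lie on
a common face; so they have the same colour and cannot be on opposite sides of the white edge.

The amplitudes supported on ±j modulo 2k, with j odd and 1 ≤ j ≤ k, are separated by evaluation at
suitable cells. This yields ⌈k/2⌉ functions for σ = 1. For σ = -1 the value j = k is lost, since k ≡
-k and the two contributions cancel; ⌊k/2⌋ remain. -/

set_option linter.unusedSectionVars false

/-! ### Symmetries and adjacency of the small triangles -/

namespace SmallTriangle

open Eisenstein

/-- The image of a small triangle under `Eisenstein.rotate z`. -/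
def rot (z : ℤ × ℤ) : SmallTriangle → SmallTriangle
  | up a b => up (b - z.2) (z.1 + z.2 - a - b - 1)
  | down a b => down (b + 1 - z.2) (z.1 + z.2 - a - b - 1)

/-- The image of a small triangle under `Eisenstein.flip z`. -/
def flp (z : ℤ × ℤ) : SmallTriangle → SmallTriangle
  | up a b => down (z.1 - z.2 - a) (z.1 + 2 * z.2 - b - 1)
  | down a b => up (z.1 - z.2 - a) (z.1 + 2 * z.2 - b - 1)

theorem vertices_rot (z : ℤ × ℤ) (t : SmallTriangle) :
    (t.rot z).vertices = t.vertices.image (rotate z) := by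
  rcases t with ⟨a, b⟩ | ⟨a, b⟩ <;> ext ⟨x, y⟩ <;>
    simp only [rot, vertices, rotate, mulOmega, Finset.image_insert, Finset.image_singleton,
      Finset.mem_insert, Finset.mem_singleton, Prod.mk.injEq, Prod.fst_sub, Prod.snd_sub] <;> omega

theorem vertices_flp (z : ℤ × ℤ) (t : SmallTriangle) :
    (t.flp z).vertices = t.vertices.image (Eisenstein.flip z) := by
  obtain ⟨k, l⟩ := z
  rcases t with ⟨a, b⟩ | ⟨a, b⟩ <;> ext ⟨x, y⟩ <;>
    simp only [flp, vertices, Eisenstein.flip, mulOmega, Finset.image_insert,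
      Finset.image_singleton, Finset.mem_insert, Finset.mem_singleton, Prod.mk.injEq,
      Prod.mk_add_mk, Prod.mk_sub_mk] <;> omega

/-- The gluings are given by vertex sets; this turns them into equations between small triangles. -/
theorem vertices_injective : Function.Injective vertices := by
  intro t t' h
  have key : ∀ w, w ∈ t.vertices ↔ w ∈ t'.vertices := fun w => by rw [h]
  rcases t with ⟨a, b⟩ | ⟨a, b⟩ <;> rcases t' with ⟨a', b'⟩ | ⟨a', b'⟩ <;>
    simp only [vertices, Finset.mem_insert, Finset.mem_singleton, Prod.forall,
      Prod.mk.injEq] at key <;>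
    have h1 := key a b <;> have h2 := key a (b + 1) <;> have h3 := key a' b' <;>
    have h4 := key a' (b' + 1) <;> have h5 := key (a + 1) b <;> have h6 := key (a' + 1) b' <;>
    clear key h <;> simp only [up.injEq, down.injEq, reduceCtorEq] <;> grind

theorem rot_rot_rot (z : ℤ × ℤ) (t : SmallTriangle) : ((t.rot z).rot z).rot z = t := by
  rcases t with ⟨a, b⟩ | ⟨a, b⟩ <;> simp only [rot, up.injEq, down.injEq] <;> omega

theorem flp_flp (z : ℤ × ℤ) (t : SmallTriangle) : (t.flp z).flp z = t := by
  rcases t with ⟨a, b⟩ | ⟨a, b⟩ <;> simp only [flp, up.injEq, down.injEq] <;> omega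

/-- Adjacency of small triangles in the plane. -/
def Adjacent (t s : SmallTriangle) : Prop := ShareEdge t.vertices s.vertices

theorem Adjacent.symm {t s : SmallTriangle} (h : t.Adjacent s) : s.Adjacent t := by
  unfold Adjacent ShareEdge at *
  rwa [Finset.inter_comm]

theorem rotate_injective (z : ℤ × ℤ) : Function.Injective (rotate z) := by
  rintro ⟨a, b⟩ ⟨a', b'⟩ h
  simp only [rotate, mulOmega, Prod.mk.injEq, Prod.fst_sub, Prod.snd_sub] at h ⊢
  omega

theorem flip_injective (z : ℤ × ℤ) : Function.Injective (Eisenstein.flip z) := by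
  exact sub_right_injective

theorem adjacent_rot_iff (z : ℤ × ℤ) {t s : SmallTriangle} :
    (t.rot z).Adjacent (s.rot z) ↔ t.Adjacent s := by
  simp only [Adjacent, ShareEdge, vertices_rot]
  rw [← Finset.image_inter _ _ (rotate_injective z),
    Finset.card_image_of_injective _ (rotate_injective z)]

theorem adjacent_flp_iff (z : ℤ × ℤ) {t s : SmallTriangle} :
    (t.flp z).Adjacent (s.flp z) ↔ t.Adjacent s := by
  simp only [Adjacent, ShareEdge, vertices_flp]
  rw [← Finset.image_inter _ _ (flip_injective z),
    Finset.card_image_of_injective _ (flip_injective z)]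

/-- The three neighbours of a small triangle. -/
def nbr : SmallTriangle → Fin 3 → SmallTriangle
  | up a b => ![down a b, down (a + 1) b, down (a + 1) (b - 1)]
  | down a b => ![up a b, up (a - 1) b, up (a - 1) (b + 1)]

theorem nbr_injective (t : SmallTriangle) : Function.Injective t.nbr := by
  rcases t with ⟨a, b⟩ | ⟨a, b⟩ <;> intro i j <;> fin_cases i <;> fin_cases j <;>
    simp [nbr] <;> omega

theorem ShareEdge.exists_three {T T' : Finset (ℤ × ℤ)} (h : ShareEdge T T') :
    ∃ u v, u ≠ v ∧ u ∈ T ∧ v ∈ T ∧ u ∈ T' ∧ v ∈ T' := by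
  obtain ⟨u, v, huv, h⟩ := Finset.card_eq_two.1 h
  have hu : u ∈ T ∩ T' := by simp [h]
  have hv : v ∈ T ∩ T' := by simp [h]
  simp only [Finset.mem_inter] at hu hv
  exact ⟨u, v, huv, hu.1, hv.1, hu.2, hv.2⟩

theorem adjacent_up_down {a b a' b' : ℤ} : (up a b).Adjacent (down a' b') ↔
    (a' = a ∧ b' = b) ∨ (a' = a + 1 ∧ b' = b) ∨ (a' = a + 1 ∧ b' = b - 1) := by
  constructor
  · intro h
    obtain ⟨⟨x, y⟩, ⟨x', y'⟩, h1, h2, h3, h4, h5⟩ := ShareEdge.exists_three h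
    simp only [vertices, Finset.mem_insert, Finset.mem_singleton, Prod.mk.injEq, ne_eq] at *
    omega
  · rintro (⟨rfl, rfl⟩ | ⟨rfl, rfl⟩ | ⟨rfl, rfl⟩) <;>
      refine Finset.card_eq_two.2 ?_
    · refine ⟨(a', b'), (a', b' + 1), by simp, ?_⟩
      ext ⟨x, y⟩
      simp only [vertices, Finset.mem_inter, Finset.mem_insert, Finset.mem_singleton,
        Prod.mk.injEq]
      omega
    · refine ⟨(a + 1, b'), (a, b' + 1), by simp, ?_⟩
      ext ⟨x, y⟩
      simp only [vertices, Finset.mem_inter, Finset.mem_insert, Finset.mem_singleton,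
        Prod.mk.injEq]
      omega
    · refine ⟨(a + 1, b), (a, b), by simp, ?_⟩
      ext ⟨x, y⟩
      simp only [vertices, Finset.mem_inter, Finset.mem_insert, Finset.mem_singleton,
        Prod.mk.injEq]
      omega

theorem not_adjacent_up_up {a b a' b' : ℤ} : ¬ (up a b).Adjacent (up a' b') := by
  intro h
  by_cases heq : a = a' ∧ b = b'
  · obtain ⟨rfl, rfl⟩ := heq
    simp only [Adjacent, ShareEdge, Finset.inter_self] at h
    simp [vertices] at h
  · obtain ⟨⟨x, y⟩, ⟨x', y'⟩, h1, h2, h3, h4, h5⟩ := ShareEdge.exists_three h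
    simp only [vertices, Finset.mem_insert, Finset.mem_singleton, Prod.mk.injEq, ne_eq] at *
    omega

theorem not_adjacent_down_down {a b a' b' : ℤ} : ¬ (down a b).Adjacent (down a' b') := by
  intro h
  by_cases heq : a = a' ∧ b = b'
  · obtain ⟨rfl, rfl⟩ := heq
    simp only [Adjacent, ShareEdge, Finset.inter_self] at h
    rw [vertices, Finset.card_insert_of_notMem (by simp), Finset.card_pair (by simp; omega)] at h
    omega
  · obtain ⟨⟨x, y⟩, ⟨x', y'⟩, h1, h2, h3, h4, h5⟩ := ShareEdge.exists_three h
    simp only [vertices, Finset.mem_insert, Finset.mem_singleton, Prod.mk.injEq, ne_eq] at *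
    omega

theorem adjacent_down_up {a b a' b' : ℤ} : (down a b).Adjacent (up a' b') ↔
    (a' = a ∧ b' = b) ∨ (a' = a - 1 ∧ b' = b) ∨ (a' = a - 1 ∧ b' = b + 1) := by
  rw [show (down a b).Adjacent (up a' b') ↔ (up a' b').Adjacent (down a b) from
    ⟨Adjacent.symm, Adjacent.symm⟩, adjacent_up_down]
  omega

theorem adjacent_iff {t s : SmallTriangle} : t.Adjacent s ↔ ∃ i, s = t.nbr i := by
  rcases t with ⟨a, b⟩ | ⟨a, b⟩ <;> rcases s with ⟨a', b'⟩ | ⟨a', b'⟩ <;>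
    simp [nbr, Fin.exists_fin_succ, adjacent_up_down, adjacent_down_up, not_adjacent_up_up,
      not_adjacent_down_down]

theorem not_adjacent_self (t : SmallTriangle) : ¬ t.Adjacent t := by
  rcases t with ⟨a, b⟩ | ⟨a, b⟩
  exacts [not_adjacent_up_up, not_adjacent_down_down]

/-! ### The cells of the triangles `0, k, ω k` and `0, (1 + ω) k, ω (1 + ω) k` -/

theorem solid_subset_of_le {t : SmallTriangle} {p q c : ℝ}
    (h : ∀ w ∈ t.vertices, p * w.1 + q * w.2 ≤ c) : ∀ x ∈ t.solid, p * x.1 + q * x.2 ≤ c := by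
  have hconv : Convex ℝ {x : ℝ × ℝ | p * x.1 + q * x.2 ≤ c} := by
    have hlin : IsLinearMap ℝ fun x : ℝ × ℝ => p * x.1 + q * x.2 :=
      ⟨fun x y => by simp; ring, fun r x => by simp; ring⟩
    exact convex_halfSpace_le hlin c
  refine fun x hx => convexHull_min ?_ hconv hx
  rintro _ ⟨w, hw, rfl⟩
  exact h w hw

theorem mem_convexHull_triple {E : Type*} [AddCommGroup E] [Module ℝ E] {S : Set E} {x y z : E}
    (hx : x ∈ S) (hy : y ∈ S) (hz : z ∈ S) {p q r : ℝ} (hp : 0 ≤ p) (hq : 0 ≤ q) (hr : 0 ≤ r)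
    (h : p + q + r = 1) : p • x + q • y + r • z ∈ convexHull ℝ S := by
  have := (convex_convexHull ℝ S).sum_mem (t := Finset.univ) (w := ![p, q, r]) (z := ![x, y, z])
    (by intro i _; fin_cases i <;> simpa) (by simp [Fin.sum_univ_three, h])
    (by intro i _; fin_cases i <;> simpa using subset_convexHull ℝ S ‹_›)
  simpa [Fin.sum_univ_three] using this

theorem mem_solid_up {a b : ℤ} {x y : ℝ} (h1 : (a : ℝ) ≤ x) (h2 : (b : ℝ) ≤ y)
    (h3 : x + y ≤ a + b + 1) : (x, y) ∈ (up a b).solid := by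
  have := mem_convexHull_triple (S := toPlane '' ((up a b).vertices : Set (ℤ × ℤ)))
    (x := toPlane (a, b)) (y := toPlane (a + 1, b)) (z := toPlane (a, b + 1))
    (Set.mem_image_of_mem _ (by simp [vertices])) (Set.mem_image_of_mem _ (by simp [vertices]))
    (Set.mem_image_of_mem _ (by simp [vertices]))
    (p := 1 - (x - a) - (y - b)) (q := x - a) (r := y - b) (by linarith) (by linarith)
    (by linarith) (by ring)
  simp only [toPlane, Int.cast_add, Int.cast_one, Prod.smul_mk, smul_eq_mul,
    Prod.mk_add_mk] at this
  ring_nf at this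
  exact this

theorem mem_solid_down {a b : ℤ} {x y : ℝ} (h1 : x ≤ a) (h2 : y ≤ b + 1)
    (h3 : a + b ≤ x + y) : (x, y) ∈ (down a b).solid := by
  have := mem_convexHull_triple (S := toPlane '' ((down a b).vertices : Set (ℤ × ℤ)))
    (x := toPlane (a, b)) (y := toPlane (a, b + 1)) (z := toPlane (a - 1, b + 1))
    (Set.mem_image_of_mem _ (by simp [vertices])) (Set.mem_image_of_mem _ (by simp [vertices]))
    (Set.mem_image_of_mem _ (by simp [vertices]))
    (p := b + 1 - y) (q := x + y - a - b) (r := a - x) (by linarith) (by linarith)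
    (by linarith) (by ring)
  simp only [toPlane, Int.cast_add, Int.cast_sub, Int.cast_one, Prod.smul_mk, smul_eq_mul,
    Prod.mk_add_mk] at this
  ring_nf at this
  exact this

end SmallTriangle

namespace SmallTriangle

open Eisenstein

theorem mem_openTriangle_axis {k : ℤ} (hk : 0 < k) {x y : ℝ} :
    (x, y) ∈ openTriangle (k, 0) ↔ 0 < x ∧ 0 < y ∧ x + y < k := by
  have hk' : (0 : ℝ) < k := by exact_mod_cast hk
  simp only [openTriangle, toPlane, mulOmega, Set.mem_ofPred_eq, Prod.smul_mk, smul_eq_mul,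
    Prod.mk_add_mk, Prod.mk.injEq, neg_zero, Int.cast_zero, mul_zero, add_zero, zero_add]
  constructor
  · rintro ⟨s, t, hs, ht, hst, rfl, rfl⟩
    refine ⟨by positivity, by positivity, by nlinarith⟩
  · rintro ⟨hx, hy, hxy⟩
    refine ⟨x / k, y / k, by positivity, by positivity, ?_, by field_simp, by field_simp⟩
    rw [← add_div, div_lt_one hk']
    exact hxy

theorem mem_openTriangle_diagonal {k : ℤ} (hk : 0 < k) {x y : ℝ} :
    (x, y) ∈ openTriangle (k, k) ↔ x < y ∧ 0 < 2 * x + y ∧ x + 2 * y < 3 * k := by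
  have hk' : (0 : ℝ) < k := by exact_mod_cast hk
  simp only [openTriangle, toPlane, mulOmega, Set.mem_ofPred_eq, Prod.smul_mk, smul_eq_mul,
    Prod.mk_add_mk, Prod.mk.injEq, Int.cast_neg, Int.cast_add]
  constructor
  · rintro ⟨s, t, hs, ht, hst, rfl, rfl⟩
    have := mul_pos hs hk'
    have := mul_pos ht hk'
    refine ⟨by nlinarith, by nlinarith, by nlinarith⟩
  · rintro ⟨hx, hy, hxy⟩
    refine ⟨(2 * x + y) / (3 * k), (y - x) / (3 * k), by positivity,
      div_pos (by linarith) (by positivity), ?_, by field_simp; ring, by field_simp; ring⟩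
    rw [← add_div, div_lt_one (by positivity)]
    linarith

/-- For each side of the large triangle, the extreme vertex of the small one must lie strictly on
the inner side; between integers a strict inequality gains one. Conversely the barycentre lies
inside. -/
theorem meets_axis_up {k : ℤ} (hk : 0 < k) {a b : ℤ} :
    (up a b).Meets (k, 0) ↔ 0 ≤ a ∧ 0 ≤ b ∧ a + b + 1 ≤ k := by
  constructor
  · rintro ⟨⟨x, y⟩, hs, ho⟩
    rw [mem_openTriangle_axis hk] at ho
    have h1 := solid_subset_of_le (t := up a b) (p := 1) (q := 0) (c := a + 1)
      (by
          simp only [vertices, Finset.forall_mem_insert, Finset.mem_singleton, forall_eq]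
          push_cast
          refine ⟨?_, ?_, ?_⟩ <;> linarith) _ hs
    have h2 := solid_subset_of_le (t := up a b) (p := 0) (q := 1) (c := b + 1)
      (by
          simp only [vertices, Finset.forall_mem_insert, Finset.mem_singleton, forall_eq]
          push_cast
          refine ⟨?_, ?_, ?_⟩ <;> linarith) _ hs
    have h3 := solid_subset_of_le (t := up a b) (p := -1) (q := -1) (c := -a - b)
      (by
          simp only [vertices, Finset.forall_mem_insert, Finset.mem_singleton, forall_eq]
          push_cast
          refine ⟨?_, ?_, ?_⟩ <;> linarith) _ hs
    simp only at h1 h2 h3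
    have e1 : (-1 : ℝ) < a := by linarith
    have e2 : (-1 : ℝ) < b := by linarith
    have e3 : (a + b : ℝ) < k := by linarith
    have f1 : -1 < a := by exact_mod_cast e1
    have f2 : -1 < b := by exact_mod_cast e2
    have f3 : a + b < k := by exact_mod_cast e3
    omega
  · rintro ⟨h1, h2, h3⟩
    have h1 : (0 : ℝ) ≤ a := by exact_mod_cast h1
    have h2 : (0 : ℝ) ≤ b := by exact_mod_cast h2
    have h3 : (a + b + 1 : ℝ) ≤ k := by exact_mod_cast h3
    exact ⟨(a + 1 / 3, b + 1 / 3), mem_solid_up (by linarith) (by linarith) (by linarith),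
      (mem_openTriangle_axis hk).2 ⟨by linarith, by linarith, by linarith⟩⟩

theorem meets_axis_down {k : ℤ} (hk : 0 < k) {a b : ℤ} :
    (down a b).Meets (k, 0) ↔ 1 ≤ a ∧ 0 ≤ b ∧ a + b + 1 ≤ k := by
  constructor
  · rintro ⟨⟨x, y⟩, hs, ho⟩
    rw [mem_openTriangle_axis hk] at ho
    have h1 := solid_subset_of_le (t := down a b) (p := 1) (q := 0) (c := a)
      (by
          simp only [vertices, Finset.forall_mem_insert, Finset.mem_singleton, forall_eq]
          push_cast
          refine ⟨?_, ?_, ?_⟩ <;> linarith) _ hs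
    have h2 := solid_subset_of_le (t := down a b) (p := 0) (q := 1) (c := b + 1)
      (by
          simp only [vertices, Finset.forall_mem_insert, Finset.mem_singleton, forall_eq]
          push_cast
          refine ⟨?_, ?_, ?_⟩ <;> linarith) _ hs
    have h3 := solid_subset_of_le (t := down a b) (p := -1) (q := -1) (c := -a - b)
      (by
          simp only [vertices, Finset.forall_mem_insert, Finset.mem_singleton, forall_eq]
          push_cast
          refine ⟨?_, ?_, ?_⟩ <;> linarith) _ hs
    simp only at h1 h2 h3
    have e1 : (0 : ℝ) < a := by linarith
    have e2 : (-1 : ℝ) < b := by linarith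
    have e3 : (a + b : ℝ) < k := by linarith
    have f1 : 0 < a := by exact_mod_cast e1
    have f2 : -1 < b := by exact_mod_cast e2
    have f3 : a + b < k := by exact_mod_cast e3
    omega
  · rintro ⟨h1, h2, h3⟩
    have h1 : (1 : ℝ) ≤ a := by exact_mod_cast h1
    have h2 : (0 : ℝ) ≤ b := by exact_mod_cast h2
    have h3 : (a + b + 1 : ℝ) ≤ k := by exact_mod_cast h3
    exact ⟨(a - 1 / 3, b + 2 / 3), mem_solid_down (by linarith) (by linarith) (by linarith),
      (mem_openTriangle_axis hk).2 ⟨by linarith, by linarith, by linarith⟩⟩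

/-- The parameter used to push the barycentre of a small triangle into the open triangle. -/
theorem exists_push (a b k : ℤ) (hk : 0 < k) : ∃ e : ℝ, 0 < e ∧ e ≤ 1 / 4 ∧
    |e * a| ≤ 1 / 8 ∧ |e * b| ≤ 1 / 8 ∧ |e * k| ≤ 1 / 16 := by
  have hk' : (1 : ℝ) ≤ k := by exact_mod_cast hk
  have ha := abs_nonneg (a : ℝ)
  have hb := abs_nonneg (b : ℝ)
  set n : ℝ := |(a : ℝ)| + |(b : ℝ)| + k with hn
  have hn0 : 0 < n := by linarith
  refine ⟨1 / (16 * n), by positivity, ?_, ?_, ?_, ?_⟩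
  · rw [div_le_div_iff₀ (by positivity) (by norm_num)]; linarith
  · rw [abs_mul, abs_of_pos (by positivity), one_div_mul_eq_div, div_le_div_iff₀ (by positivity)
      (by norm_num)]; linarith
  · rw [abs_mul, abs_of_pos (by positivity), one_div_mul_eq_div, div_le_div_iff₀ (by positivity)
      (by norm_num)]; linarith
  · rw [abs_mul, abs_of_pos (by positivity), one_div_mul_eq_div, div_le_div_iff₀ (by positivity)
      (by norm_num), abs_of_pos (by linarith)]; linarith

theorem meets_diagonal_up {k : ℤ} (hk : 0 < k) {a b : ℤ} :
    (up a b).Meets (k, k) ↔ a ≤ b ∧ 0 ≤ 2 * a + b + 1 ∧ a + 2 * b + 1 ≤ 3 * k := by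
  constructor
  · rintro ⟨⟨x, y⟩, hs, ho⟩
    rw [mem_openTriangle_diagonal hk] at ho
    have h1 := solid_subset_of_le (t := up a b) (p := -1) (q := 1) (c := b - a + 1)
      (by
          simp only [vertices, Finset.forall_mem_insert, Finset.mem_singleton, forall_eq]
          push_cast
          refine ⟨?_, ?_, ?_⟩ <;> linarith) _ hs
    have h2 := solid_subset_of_le (t := up a b) (p := 2) (q := 1) (c := 2 * a + b + 2)
      (by
          simp only [vertices, Finset.forall_mem_insert, Finset.mem_singleton, forall_eq]
          push_cast
          refine ⟨?_, ?_, ?_⟩ <;> linarith) _ hs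
    have h3 := solid_subset_of_le (t := up a b) (p := -1) (q := -2) (c := -a - 2 * b)
      (by
          simp only [vertices, Finset.forall_mem_insert, Finset.mem_singleton, forall_eq]
          push_cast
          refine ⟨?_, ?_, ?_⟩ <;> linarith) _ hs
    simp only at h1 h2 h3
    have e1 : (a : ℝ) < b + 1 := by linarith
    have e2 : (0 : ℝ) < 2 * a + b + 2 := by linarith
    have e3 : (a + 2 * b : ℝ) < 3 * k := by linarith
    have f1 : a < b + 1 := by exact_mod_cast e1
    have f2 : 0 < 2 * a + b + 2 := by exact_mod_cast e2
    have f3 : a + 2 * b < 3 * k := by exact_mod_cast e3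
    omega
  · rintro ⟨h1, h2, h3⟩
    have h1 : (a : ℝ) ≤ b := by exact_mod_cast h1
    have h2 : (0 : ℝ) ≤ 2 * a + b + 1 := by exact_mod_cast h2
    have h3 : (a + 2 * b + 1 : ℝ) ≤ 3 * k := by exact_mod_cast h3
    obtain ⟨e, he, he1, ha, hb, hk1⟩ := exists_push a b k hk
    rw [abs_le] at ha hb hk1
    have hk' : (0 : ℝ) < k := by exact_mod_cast hk
    have hek := mul_pos he hk'
    have g1 := mul_nonneg (show 0 ≤ 1 - e by linarith) (sub_nonneg.2 h1)
    have g2 := mul_nonneg (show 0 ≤ 1 - e by linarith) h2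
    have g3 := mul_nonneg (show 0 ≤ 1 - e by linarith) (sub_nonneg.2 h3)
    -- A side may pass through the barycentre, which is therefore moved slightly towards (0, k), the
    -- centre of the large triangle.
    exact ⟨((1 - e) * (a + 1 / 3), (1 - e) * (b + 1 / 3) + e * k),
      mem_solid_up (by linarith) (by linarith) (by linarith),
      (mem_openTriangle_diagonal hk).2 ⟨by linarith, by linarith, by linarith⟩⟩

theorem meets_diagonal_down {k : ℤ} (hk : 0 < k) {a b : ℤ} :
    (down a b).Meets (k, k) ↔ a ≤ b + 1 ∧ 0 ≤ 2 * a + b ∧ a + 2 * b + 1 ≤ 3 * k := by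
  constructor
  · rintro ⟨⟨x, y⟩, hs, ho⟩
    rw [mem_openTriangle_diagonal hk] at ho
    have h1 := solid_subset_of_le (t := down a b) (p := -1) (q := 1) (c := b - a + 2)
      (by
          simp only [vertices, Finset.forall_mem_insert, Finset.mem_singleton, forall_eq]
          push_cast
          refine ⟨?_, ?_, ?_⟩ <;> linarith) _ hs
    have h2 := solid_subset_of_le (t := down a b) (p := 2) (q := 1) (c := 2 * a + b + 1)
      (by
          simp only [vertices, Finset.forall_mem_insert, Finset.mem_singleton, forall_eq]
          push_cast
          refine ⟨?_, ?_, ?_⟩ <;> linarith) _ hs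
    have h3 := solid_subset_of_le (t := down a b) (p := -1) (q := -2) (c := -a - 2 * b)
      (by
          simp only [vertices, Finset.forall_mem_insert, Finset.mem_singleton, forall_eq]
          push_cast
          refine ⟨?_, ?_, ?_⟩ <;> linarith) _ hs
    simp only at h1 h2 h3
    have e1 : (a : ℝ) < b + 2 := by linarith
    have e2 : (0 : ℝ) < 2 * a + b + 1 := by linarith
    have e3 : (a + 2 * b : ℝ) < 3 * k := by linarith
    have f1 : a < b + 2 := by exact_mod_cast e1
    have f2 : 0 < 2 * a + b + 1 := by exact_mod_cast e2
    have f3 : a + 2 * b < 3 * k := by exact_mod_cast e3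
    omega
  · rintro ⟨h1, h2, h3⟩
    have h1 : (a : ℝ) ≤ b + 1 := by exact_mod_cast h1
    have h2 : (0 : ℝ) ≤ 2 * a + b := by exact_mod_cast h2
    have h3 : (a + 2 * b + 1 : ℝ) ≤ 3 * k := by exact_mod_cast h3
    obtain ⟨e, he, he1, ha, hb, hk1⟩ := exists_push a b k hk
    rw [abs_le] at ha hb hk1
    have hk' : (0 : ℝ) < k := by exact_mod_cast hk
    have hek := mul_pos he hk'
    have g1 := mul_nonneg (show 0 ≤ 1 - e by linarith) (sub_nonneg.2 h1)
    have g2 := mul_nonneg (show 0 ≤ 1 - e by linarith) h2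
    have g3 := mul_nonneg (show 0 ≤ 1 - e by linarith) (sub_nonneg.2 h3)
    exact ⟨((1 - e) * (a - 1 / 3), (1 - e) * (b + 2 / 3) + e * k),
      mem_solid_down (by linarith) (by linarith) (by linarith),
      (mem_openTriangle_diagonal hk).2 ⟨by linarith, by linarith, by linarith⟩⟩

/-! ### Incidences between the cells of adjacent triangles -/

/-- The incidences between the cells of the triangle `0, z, ω z` and of the three adjacent triangles
on which the combinatorics of the Goldberg–Coxeter construction depends. -/
structure CellGeometry (z : ℤ × ℤ) : Prop where
  meets_rot : ∀ t : SmallTriangle, (t.rot z).Meets z ↔ t.Meets z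
  -- A cell belongs to at most two copies, so a chain of gluings crosses effectively at most once.
  not_meets_two : ∀ t : SmallTriangle, t.Meets z → (t.flp z).Meets z → ¬ ((t.rot z).flp z).Meets z
  meets_of_adjacent : ∀ t s : SmallTriangle, t.Meets z → t.Adjacent s → s.Meets z ∨ (s.flp z).Meets z ∨
    ((s.rot z).flp z).Meets z ∨ (((s.rot z).rot z).flp z).Meets z
  meets_of_adjacent_of_flp : ∀ t s : SmallTriangle, t.Meets z → (t.flp z).Meets z → t.Adjacent s →
    s.Meets z ∨ (s.flp z).Meets z
  not_meets_flp_rot : ∀ t s : SmallTriangle, t.Meets z → t.Adjacent s → ¬ s.Meets z → (s.flp z).Meets z →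
    ¬ ((s.rot z).flp z).Meets z
  -- Either the sides cut no cell, or a cell outside the triangle is reached across a side only from
  -- a cell cut by that side.
  flp_cases : (∀ t : SmallTriangle, t.Meets z → ¬ (t.flp z).Meets z) ∨ ∀ t s : SmallTriangle, t.Meets z → t.Adjacent s →
    ¬ s.Meets z → (s.flp z).Meets z → (t.flp z).Meets z

/-- The sides are lattice lines, so the cells tile the triangle and none is cut. Cells being
described by linear inequalities over ℤ, every incidence is decided by `omega`. -/
theorem cellGeometry_axis {k : ℤ} (hk : 0 < k) : CellGeometry (k, 0) where
  meets_rot t := by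
    rcases t with ⟨a, b⟩ | ⟨a, b⟩ <;> simp only [rot, meets_axis_up hk, meets_axis_down hk] <;>
      omega
  not_meets_two t := by
    rcases t with ⟨a, b⟩ | ⟨a, b⟩ <;>
      simp only [rot, flp, meets_axis_up hk, meets_axis_down hk] <;> omega
  meets_of_adjacent t s h h' := by
    rcases t with ⟨a, b⟩ | ⟨a, b⟩ <;> rcases s with ⟨a', b'⟩ | ⟨a', b'⟩ <;>
      simp only [rot, flp, meets_axis_up hk, meets_axis_down hk, adjacent_up_down,
        adjacent_down_up, not_adjacent_up_up, not_adjacent_down_down] at * <;> omega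
  meets_of_adjacent_of_flp t s h h' h'' := by
    rcases t with ⟨a, b⟩ | ⟨a, b⟩ <;> rcases s with ⟨a', b'⟩ | ⟨a', b'⟩ <;>
      simp only [flp, meets_axis_up hk, meets_axis_down hk] at * <;> omega
  not_meets_flp_rot t s h h' h'' h''' := by
    rcases t with ⟨a, b⟩ | ⟨a, b⟩ <;> rcases s with ⟨a', b'⟩ | ⟨a', b'⟩ <;>
      simp only [rot, flp, meets_axis_up hk, meets_axis_down hk, adjacent_up_down,
        adjacent_down_up, not_adjacent_up_up, not_adjacent_down_down] at * <;> omega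
  flp_cases := by
    left
    intro t
    rcases t with ⟨a, b⟩ | ⟨a, b⟩ <;> simp only [flp, meets_axis_up hk, meets_axis_down hk] <;>
      omega

/-- Here the sides run along medians of small triangles, so the cells along a side are shared by two
copies. -/
theorem cellGeometry_diagonal {k : ℤ} (hk : 0 < k) : CellGeometry (k, k) where
  meets_rot t := by
    rcases t with ⟨a, b⟩ | ⟨a, b⟩ <;>
      simp only [rot, meets_diagonal_up hk, meets_diagonal_down hk] <;> omega
  not_meets_two t := by
    rcases t with ⟨a, b⟩ | ⟨a, b⟩ <;>
      simp only [rot, flp, meets_diagonal_up hk, meets_diagonal_down hk] <;> omega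
  meets_of_adjacent t s h h' := by
    rcases t with ⟨a, b⟩ | ⟨a, b⟩ <;> rcases s with ⟨a', b'⟩ | ⟨a', b'⟩ <;>
      simp only [rot, flp, meets_diagonal_up hk, meets_diagonal_down hk, adjacent_up_down,
        adjacent_down_up, not_adjacent_up_up, not_adjacent_down_down] at * <;> omega
  meets_of_adjacent_of_flp t s h h' h'' := by
    rcases t with ⟨a, b⟩ | ⟨a, b⟩ <;> rcases s with ⟨a', b'⟩ | ⟨a', b'⟩ <;>
      simp only [flp, meets_diagonal_up hk, meets_diagonal_down hk, adjacent_up_down,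
        adjacent_down_up, not_adjacent_up_up, not_adjacent_down_down] at * <;> omega
  not_meets_flp_rot t s h h' h'' h''' := by
    rcases t with ⟨a, b⟩ | ⟨a, b⟩ <;> rcases s with ⟨a', b'⟩ | ⟨a', b'⟩ <;>
      simp only [rot, flp, meets_diagonal_up hk, meets_diagonal_down hk, adjacent_up_down,
        adjacent_down_up, not_adjacent_up_up, not_adjacent_down_down] at * <;> omega
  flp_cases := by
    right
    intro t s h h' h'' h'''
    rcases t with ⟨a, b⟩ | ⟨a, b⟩ <;> rcases s with ⟨a', b'⟩ | ⟨a', b'⟩ <;>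
      simp only [flp, meets_diagonal_up hk, meets_diagonal_down hk, adjacent_up_down,
        adjacent_down_up, not_adjacent_up_up, not_adjacent_down_down] at * <;> omega

end SmallTriangle

/-! ### The three darts at a vertex of a cubic graph -/

namespace RotationSystem

variable {V : Type*} [Fintype V] [DecidableEq V] {X : SimpleGraph V} [DecidableRel X.Adj]

theorem fst_iterate_next (R : RotationSystem X) (d : X.Dart) (i : ℕ) :
    (R.next^[i] d).fst = d.fst := by
  induction i with
  | zero => rfl
  | succ i ih => rw [Function.iterate_succ_apply', R.fst_next, ih]

theorem exists_iterate_of_fst_eq (R : RotationSystem X) {d d' : X.Dart} (h : d.fst = d'.fst) :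
    ∃ i : ℕ, R.next^[i] d = d' := by
  obtain ⟨i, -, hi⟩ := (R.sameCycle_of_fst_eq d d' h).exists_pow_eq'
  exact ⟨i, by rw [← Equiv.Perm.coe_pow]; exact hi⟩

/-- The first n iterates already exhaust the orbit of d, which consists of the three darts at its
vertex. -/
theorem card_le_of_iterate_eq (R : RotationSystem X) (hX : X.IsRegularOfDegree 3) (d : X.Dart)
    {n : ℕ} (hn : 0 < n) (h : R.next^[n] d = d) : 3 ≤ n := by
  have hsub : (Finset.univ.filter fun d' : X.Dart => d'.fst = d.fst) ⊆
      (Finset.range n).image fun i => R.next^[i] d := by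
    intro d' hd'
    obtain ⟨i, hi⟩ := R.exists_iterate_of_fst_eq (Finset.mem_filter.1 hd').2.symm
    refine Finset.mem_image.2 ⟨i % n, Finset.mem_range.2 (Nat.mod_lt _ hn), ?_⟩
    rw [← hi]
    exact Function.IsPeriodicPt.iterate_mod_apply h i
  have h1 := (Finset.card_le_card hsub).trans Finset.card_image_le
  rwa [X.dart_fst_fiber_card_eq_degree, hX.degree_eq, Finset.card_range] at h1

theorem iterate_three_next (R : RotationSystem X) (hX : X.IsRegularOfDegree 3) (d : X.Dart) :
    R.next^[3] d = d := by
  have hne : ∀ n, 0 < n → n < 3 → R.next^[n] d ≠ d := fun n h0 h3 h => by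
    have := R.card_le_of_iterate_eq hX d h0 h
    omega
  have hinj : Set.InjOn (fun i => R.next^[i] d) (Finset.range 4 : Finset ℕ) → False := by
    intro hinj
    have hsub : (Finset.range 4).image (fun i => R.next^[i] d) ⊆
        Finset.univ.filter fun d' : X.Dart => d'.fst = d.fst := by
      intro d' hd'
      obtain ⟨i, -, rfl⟩ := Finset.mem_image.1 hd'
      exact Finset.mem_filter.2 ⟨Finset.mem_univ _, R.fst_iterate_next d i⟩
    have h1 := Finset.card_le_card hsub
    rw [X.dart_fst_fiber_card_eq_degree, hX.degree_eq, Finset.card_image_of_injOn hinj,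
      Finset.card_range] at h1
    omega
  by_contra h3
  have hlt : ∀ n, 0 < n → n < 4 → R.next^[n] d ≠ d := by
    intro n h0 h4
    rcases Nat.lt_succ_iff_lt_or_eq.1 h4 with h | rfl
    exacts [hne n h0 h, h3]
  have key : ∀ i j, i < j → j < 4 → R.next^[i] d ≠ R.next^[j] d := by
    intro i j hij hj h
    obtain ⟨m, rfl⟩ := Nat.exists_eq_add_of_lt hij
    rw [add_assoc, Function.iterate_add_apply] at h
    exact hlt (m + 1) (by omega) (by omega) (R.next.injective.iterate i h).symm
  refine hinj fun i hi j hj h => ?_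
  simp only [Finset.coe_range, Set.mem_Iio] at hi hj
  rcases lt_trichotomy i j with hij | hij | hij
  exacts [(key i j hij hj h).elim, hij, (key j i hij hi h.symm).elim]

theorem next_next_next (R : RotationSystem X) (hX : X.IsRegularOfDegree 3) (d : X.Dart) :
    R.next (R.next (R.next d)) = d := R.iterate_three_next hX d

theorem mod_three_of_iterate_eq (R : RotationSystem X) (hX : X.IsRegularOfDegree 3) {d : X.Dart}
    {i : ℕ} (h : R.next^[i] d = d) : i % 3 = 0 := by
  by_contra h0
  have h1 : R.next^[i % 3] d = d := by
    rw [Function.IsPeriodicPt.iterate_mod_apply (R.iterate_three_next hX d), h]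
  have := R.card_le_of_iterate_eq hX d (Nat.pos_of_ne_zero h0) h1
  omega

theorem eq_of_fst_eq (R : RotationSystem X) (hX : X.IsRegularOfDegree 3) {d d' : X.Dart}
    (h : d.fst = d'.fst) : d' = d ∨ d' = R.next d ∨ d' = R.next (R.next d) := by
  obtain ⟨i, rfl⟩ := R.exists_iterate_of_fst_eq h
  rw [← Function.IsPeriodicPt.iterate_mod_apply (R.iterate_three_next hX d)]
  have : i % 3 < 3 := Nat.mod_lt _ (by norm_num)
  interval_cases i % 3 <;> simp

theorem next_ne (R : RotationSystem X) (hX : X.IsRegularOfDegree 3) (d : X.Dart) :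
    R.next d ≠ d := fun h => by simpa using R.mod_three_of_iterate_eq hX (i := 1) h

theorem next_next_ne (R : RotationSystem X) (hX : X.IsRegularOfDegree 3) (d : X.Dart) :
    R.next (R.next d) ≠ d := fun h => by simpa using R.mod_three_of_iterate_eq hX (i := 2) h

end RotationSystem

/-! ### The Laplacian at a vertex of degree three, and lower bounds for multiplicities -/

open Classical in
theorem graphLaplacian_apply_of_three {W : Type*} [Finite W] (H : SimpleGraph W) (f : W → ℂ)
    (v : W) (u : Fin 3 → W) (hu : Function.Injective u) (hadj : ∀ w, H.Adj v w ↔ ∃ i, w = u i) :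
    graphLaplacian H f v = 3 * f v - ∑ i, f (u i) := by
  let := Fintype.ofFinite W
  have hN : H.neighborFinset v = Finset.univ.image u := by
    ext w
    simp [hadj, eq_comm]
  have hdeg : H.degree v = 3 := by
    rw [← H.card_neighborFinset_eq_degree, hN, Finset.card_image_of_injective _ hu,
      Finset.card_univ, Fintype.card_fin]
  rw [graphLaplacian, Matrix.toLin'_apply, SimpleGraph.lapMatrix_mulVec_apply, hN, hdeg,
    Finset.sum_image hu.injOn]
  norm_num

theorem le_eigenvalueMultiplicity {W : Type*} [Finite W] (H : SimpleGraph W) (c : ℂ) {m : ℕ}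
    (g : Fin m → W → ℂ) (v : Fin m → W) (hg : ∀ i, graphLaplacian H (g i) = c • g i)
    (hdiag : ∀ i, g i (v i) ≠ 0) (hoff : ∀ i j, i ≠ j → g i (v j) = 0) :
    m ≤ eigenvalueMultiplicity H c := by
  have hmem : ∀ i, g i ∈ Module.End.eigenspace (graphLaplacian H) c := fun i =>
    Module.End.mem_eigenspace_iff.2 (hg i)
  have hli : LinearIndependent ℂ fun i =>
      (⟨g i, hmem i⟩ : Module.End.eigenspace (graphLaplacian H) c) := by
    rw [Fintype.linearIndependent_iff]
    intro a ha j
    have h1 := congrFun (congrArg Subtype.val ha) (v j)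
    simp only [Submodule.coe_sum, Submodule.coe_smul, Finset.sum_apply, Pi.smul_apply,
      smul_eq_mul, ZeroMemClass.coe_zero, Pi.zero_apply] at h1
    rw [Finset.sum_eq_single j (fun i _ hij => by rw [hoff i j hij, mul_zero])
      (fun h => (h (Finset.mem_univ j)).elim)] at h1
    exact (mul_eq_zero.1 h1).resolve_right (hdiag j)
  have := hli.fintype_card_le_finrank
  rwa [Fintype.card_fin] at this

/-! ### Normal form of the gluing relation -/

namespace GoldbergCoxeter

open SmallTriangle

section Placement

variable {V : Type*} {X : SimpleGraph V}

/-- A small triangle of the plane, seen in the placement along a dart, seen in the placement of the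
same copy along the next dart. -/
def turn (R : RotationSystem X) (z : ℤ × ℤ) (x : X.Dart × SmallTriangle) :
    X.Dart × SmallTriangle := (R.next x.1, x.2.rot z)

/-- A small triangle of the plane, seen in the placement along a dart, seen in the placement of the
adjacent copy along the reversed dart. -/
def cross (z : ℤ × ℤ) (x : X.Dart × SmallTriangle) : X.Dart × SmallTriangle :=
  (x.1.symm, x.2.flp z)

theorem cross_cross (z : ℤ × ℤ) (x : X.Dart × SmallTriangle) : cross z (cross z x) = x := by
  simp [cross, flp_flp]

theorem iterate_turn (R : RotationSystem X) (z : ℤ × ℤ) (x : X.Dart × SmallTriangle) (i : ℕ) :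
    (turn R z)^[i] x = (R.next^[i] x.1, (rot z)^[i] x.2) := by
  induction i with
  | zero => rfl
  | succ i ih => simp only [Function.iterate_succ_apply', ih, turn]

/-- The vertex represented by a pair of a dart and a cell. -/
def mk (R : RotationSystem X) (z : ℤ × ℤ) (x : X.Dart × SmallTriangle) (h : x.2.Meets z) :
    Vertex R z := vertexMk R z x.1 ⟨x.2, h⟩

theorem mk_congr {R : RotationSystem X} {z : ℤ × ℤ} {x y : X.Dart × SmallTriangle} (h : x = y)
    (hx : x.2.Meets z) (hy : y.2.Meets z) : mk R z x hx = mk R z y hy := by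
  subst h; rfl

theorem exists_mk_eq {R : RotationSystem X} {z : ℤ × ℤ} (v : Vertex R z) :
    ∃ x h, mk R z x h = v := by
  obtain ⟨⟨d, t⟩, rfl⟩ := Quot.exists_rep v
  exact ⟨(d, t.1), t.2, rfl⟩

theorem mk_turn {R : RotationSystem X} {z : ℤ × ℤ} (x : X.Dart × SmallTriangle)
    (h : x.2.Meets z) (h' : (turn R z x).2.Meets z) : mk R z (turn R z x) h' = mk R z x h :=
  (Quot.sound (Glue.turn x.1 ⟨x.2, h⟩ ⟨x.2.rot z, h'⟩ (vertices_rot z x.2))).symm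

theorem mk_cross {R : RotationSystem X} {z : ℤ × ℤ} (x : X.Dart × SmallTriangle)
    (h : x.2.Meets z) (h' : (cross z x).2.Meets z) : mk R z (cross z x) h' = mk R z x h :=
  (Quot.sound (Glue.cross x.1 ⟨x.2, h⟩ ⟨x.2.flp z, h'⟩ (vertices_flp z x.2))).symm

/-- Two pairs of a dart and a small triangle that represent the same vertex. -/
def Same (R : RotationSystem X) (z : ℤ × ℤ) (x y : X.Dart × SmallTriangle) : Prop :=
  (∃ i, y = (turn R z)^[i] x) ∨
    ∃ i j, (cross z ((turn R z)^[i] x)).2.Meets z ∧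
      y = (turn R z)^[j] (cross z ((turn R z)^[i] x))

/-- The vertex `w` is the small triangle `x.2` of the plane, laid out around the copy of the vertex
`x.1.fst` placed along the dart `x.1`. -/
def At (R : RotationSystem X) (z : ℤ × ℤ) (x : X.Dart × SmallTriangle) (w : Vertex R z) : Prop :=
  (∃ h, w = mk R z x h) ∨ ∃ i h, w = mk R z (cross z ((turn R z)^[i] x)) h

theorem Neighbour.symm {R : RotationSystem X} {z : ℤ × ℤ} {v w : Vertex R z}
    (h : Neighbour R z v w) : Neighbour R z w v := by
  rcases h with ⟨d, t, t', h⟩ | ⟨d, t, t', h⟩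
  · exact Neighbour.inside d t' t (Adjacent.symm h)
  · have h1 : t.1.Adjacent (t'.1.flp z) := by rwa [Adjacent, vertices_flp]
    have h2 : ShareEdge t'.1.vertices (t.1.vertices.image (Eisenstein.flip z)) := by
      rw [← vertices_flp]
      have := ((adjacent_flp_iff z).2 h1).symm
      rwa [flp_flp] at this
    have := Neighbour.across (R := R) d.symm t' t h2
    rwa [SimpleGraph.Dart.symm_symm] at this

end Placement

variable {V : Type*} [Fintype V] [DecidableEq V] {X : SimpleGraph V} [DecidableRel X.Adj]
  {R : RotationSystem X} {z : ℤ × ℤ}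

theorem turn_turn_turn (hX : X.IsRegularOfDegree 3) (x : X.Dart × SmallTriangle) :
    (turn R z)^[3] x = x := by
  simp [turn, R.next_next_next hX, rot_rot_rot]

theorem iterate_turn_mod (hX : X.IsRegularOfDegree 3) (x : X.Dart × SmallTriangle) (i : ℕ) :
    (turn R z)^[i % 3] x = (turn R z)^[i] x :=
  Function.IsPeriodicPt.iterate_mod_apply (turn_turn_turn hX x) i

theorem iterate_turn_congr (hX : X.IsRegularOfDegree 3) (x : X.Dart × SmallTriangle) {i j : ℕ}
    (h : i % 3 = j % 3) : (turn R z)^[i] x = (turn R z)^[j] x := by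
  rw [← iterate_turn_mod hX, h, iterate_turn_mod hX]

theorem iterate_turn_eq_of_dart_eq (hX : X.IsRegularOfDegree 3) {x : X.Dart × SmallTriangle}
    {i : ℕ} (h : ((turn R z)^[i] x).1 = x.1) : (turn R z)^[i] x = x := by
  rw [iterate_turn] at h
  rw [← iterate_turn_mod hX, R.mod_three_of_iterate_eq hX h]
  rfl

theorem fst_iterate_turn (x : X.Dart × SmallTriangle) (i : ℕ) :
    ((turn R z)^[i] x).1.fst = x.1.fst := by
  rw [iterate_turn, R.fst_iterate_next]

theorem iterate_turn_eq_of_snd_eq (hX : X.IsRegularOfDegree 3) {x : X.Dart × SmallTriangle}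
    {i j : ℕ} (h : ((turn R z)^[i] x).1.snd = ((turn R z)^[j] x).1.snd) :
    (turn R z)^[i] x = (turn R z)^[j] x := by
  have hd : ((turn R z)^[i] x).1 = ((turn R z)^[j] x).1 :=
    SimpleGraph.Dart.ext _ _ (Prod.ext (by rw [fst_iterate_turn, fst_iterate_turn]) h)
  -- Three turns are the identity, so 2 * j further turns undo j turns.
  have h3 : (turn R z)^[i] x = (turn R z)^[i + 2 * j] ((turn R z)^[j] x) := by
    rw [← Function.iterate_add_apply]
    exact iterate_turn_congr hX x (by omega)
  rw [h3]
  exact iterate_turn_eq_of_dart_eq hX (by rw [← h3, hd])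

theorem snd_iterate_turn_ne (x y : X.Dart × SmallTriangle) (hxy : x.1 = y.1) (i j : ℕ) :
    ((turn R z)^[j] (cross z ((turn R z)^[i] x))).1 ≠ y.1 := by
  intro h
  have h1 := congrArg (fun d : X.Dart => d.fst) h
  simp only [fst_iterate_turn] at h1
  have h2 := ((turn R z)^[i] x).1.adj
  rw [fst_iterate_turn, hxy, ← h1] at h2
  exact h2.ne rfl

/-- X is simple: a dart is determined by its ends, so two crossings into the same copy pass through
the same side. -/
theorem eq_of_cross_eq (hX : X.IsRegularOfDegree 3) {x y : X.Dart × SmallTriangle}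
    (hxy : x.1 = y.1) {i j l : ℕ}
    (h : cross z ((turn R z)^[i] y) = (turn R z)^[j] (cross z ((turn R z)^[l] x))) : x = y := by
  have hsnd : ((turn R z)^[i] y).1.snd = ((turn R z)^[l] x).1.snd := by
    have h1 := congrArg (fun u : X.Dart × SmallTriangle => u.1.fst) h
    rw [fst_iterate_turn] at h1
    exact h1
  have hd : ((turn R z)^[i] y).1 = ((turn R z)^[l] x).1 :=
    SimpleGraph.Dart.ext _ _ (Prod.ext (by simp only [fst_iterate_turn, hxy]) hsnd)
  have hj : (turn R z)^[j] (cross z ((turn R z)^[l] x)) = cross z ((turn R z)^[l] x) := by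
    apply iterate_turn_eq_of_dart_eq hX
    rw [← h]
    simp only [cross, hd]
  rw [hj] at h
  have h2 := congrArg (cross z) h
  rw [cross_cross, cross_cross] at h2
  have h3 : (turn R z)^[i] y = (turn R z)^[l] y := iterate_turn_eq_of_snd_eq hX (by
    rw [hsnd, iterate_turn, iterate_turn, hxy])
  have hinj : Function.Injective (turn R z) := by
    intro a b hab
    rw [← turn_turn_turn hX a (z := z) (R := R), ← turn_turn_turn hX b (z := z) (R := R)]
    simp only [Function.iterate_succ_apply, hab]
  exact (hinj.iterate l (h3.symm.trans h2)).symm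

theorem CellGeometry.meets_iterate (hz : CellGeometry z) (x : X.Dart × SmallTriangle) (i : ℕ) :
    ((turn R z)^[i] x).2.Meets z ↔ x.2.Meets z := by
  induction i with
  | zero => rfl
  | succ i ih => rw [Function.iterate_succ_apply', ← ih]; exact hz.meets_rot _

theorem adjacent_iterate {x y : X.Dart × SmallTriangle} (i : ℕ) :
    ((turn R z)^[i] x).2.Adjacent ((turn R z)^[i] y).2 ↔ x.2.Adjacent y.2 := by
  induction i with
  | zero => rfl
  | succ i ih =>
    rw [Function.iterate_succ_apply', Function.iterate_succ_apply', ← ih]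
    exact adjacent_rot_iff z

theorem mk_iterate_turn (hz : CellGeometry z) (x : X.Dart × SmallTriangle) (i : ℕ)
    (h : x.2.Meets z) (h' : ((turn R z)^[i] x).2.Meets z) :
    mk R z ((turn R z)^[i] x) h' = mk R z x h := by
  induction i with
  | zero => rfl
  | succ i ih =>
    have h2 := (CellGeometry.meets_iterate (R := R) hz x i).2 h
    rw [← ih h2, ← mk_turn _ h2 (by rwa [Function.iterate_succ_apply'] at h')]
    exact mk_congr (Function.iterate_succ_apply' _ _ _) _ _

theorem mod_three_of_meets_cross (hX : X.IsRegularOfDegree 3) (hz : CellGeometry z)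
    {x : X.Dart × SmallTriangle} (h : x.2.Meets z)
    (h0 : (cross z x).2.Meets z) {j : ℕ} (hj : (cross z ((turn R z)^[j] x)).2.Meets z) :
    j % 3 = 0 := by
  rw [← iterate_turn_mod hX] at hj
  have : j % 3 < 3 := Nat.mod_lt _ (by norm_num)
  interval_cases j % 3
  · rfl
  · exact (hz.not_meets_two _ h h0 hj).elim
  · refine (hz.not_meets_two ((turn R z)^[2] x).2 ((CellGeometry.meets_iterate hz x 2).2 h) hj
      ?_).elim
    have : ((turn R z)^[2] x).2.rot z = x.2 := rot_rot_rot z x.2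
    rw [this]
    exact h0

theorem Same.turn_iff (hX : X.IsRegularOfDegree 3) {x y : X.Dart × SmallTriangle} :
    Same R z x (turn R z y) ↔ Same R z x y := by
  constructor
  · have hy : y = (turn R z)^[2] (turn R z y) := (turn_turn_turn hX y).symm
    rintro (⟨i, h⟩ | ⟨i, j, hm, h⟩)
    · exact Or.inl ⟨2 + i, by rw [hy, h, ← Function.iterate_add_apply]⟩
    · exact Or.inr ⟨i, 2 + j, hm, by rw [hy, h, ← Function.iterate_add_apply]⟩
  · rintro (⟨i, rfl⟩ | ⟨i, j, hm, rfl⟩)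
    · exact Or.inl ⟨i + 1, by rw [Function.iterate_succ_apply']⟩
    · exact Or.inr ⟨i, j + 1, hm, by rw [Function.iterate_succ_apply']⟩

/-- A second crossing can only undo the first, since the cell already belongs to two copies and
cannot belong to a third. -/
theorem Same.cross (hX : X.IsRegularOfDegree 3) (hz : CellGeometry z)
    {x y : X.Dart × SmallTriangle} (hx : x.2.Meets z)
    (hy' : (cross z y).2.Meets z) (h : Same R z x y) : Same R z x (cross z y) := by
  rcases h with ⟨i, rfl⟩ | ⟨i, j, hm, rfl⟩
  · exact Or.inr ⟨i, 0, hy', rfl⟩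
  · have hj := mod_three_of_meets_cross (R := R) hX hz (x := GoldbergCoxeter.cross z
      ((turn R z)^[i] x)) hm
      (by rw [cross_cross]; exact (CellGeometry.meets_iterate hz x i).2 hx) hy'
    left
    refine ⟨i, ?_⟩
    rw [← iterate_turn_mod hX _ j, hj, Function.iterate_zero_apply, cross_cross]

/-- The pairs `Same` as x include x and are stable under both kinds of gluing, in both directions,
hence under the generated equivalence. -/
theorem same_of_mk_eq (hX : X.IsRegularOfDegree 3) (hz : CellGeometry z)
    {x y : X.Dart × SmallTriangle} {hx : x.2.Meets z} {hy : y.2.Meets z}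
    (h : mk R z x hx = mk R z y hy) : Same R z x y := by
  have key : ∀ a b : PlacedCell X z, Relation.EqvGen (Glue R z) a b →
      (Same R z x (a.1, a.2.1) ↔ Same R z x (b.1, b.2.1)) := by
    intro a b hab
    induction hab with
    | rel a b hab =>
      rcases hab with ⟨d, t, t', h⟩ | ⟨d, t, t', h⟩
      · rw [← vertices_rot] at h
        simp only [vertices_injective h]
        exact (Same.turn_iff hX (y := (d, t.1))).symm
      · rw [← vertices_flp] at h
        have h' := vertices_injective h
        constructor
        · intro hs
          simp only [h']
          exact Same.cross hX hz hx (y := (d, t.1)) (by rw [GoldbergCoxeter.cross, ← h']; exact t'.2) hs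
        · intro hs
          have h2 : (d, t.1) = GoldbergCoxeter.cross z (d.symm, t'.1) := by
            simp [GoldbergCoxeter.cross, h', flp_flp]
          simp only [h2]
          exact Same.cross hX hz hx (by rw [← h2]; exact t.2) hs
    | refl a => rfl
    | symm a b _ ih => exact ih.symm
    | trans a b c _ _ ih1 ih2 => exact ih1.trans ih2
  exact (key _ _ (Quot.eqvGen_exact h)).1 (Or.inl ⟨0, rfl⟩)

theorem eq_of_same (hX : X.IsRegularOfDegree 3) {x y : X.Dart × SmallTriangle}
    (hxy : x.1 = y.1) (h : Same R z x y) : x = y := by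
  rcases h with ⟨i, rfl⟩ | ⟨i, j, -, h⟩
  · exact (iterate_turn_eq_of_dart_eq hX hxy.symm).symm
  · exact (snd_iterate_turn_ne x y hxy i j (congrArg Prod.fst h.symm)).elim

theorem At.turn_iff (hX : X.IsRegularOfDegree 3) (hz : CellGeometry z)
    {x : X.Dart × SmallTriangle} {w : Vertex R z} :
    At R z (turn R z x) w ↔ At R z x w := by
  constructor
  · rintro (⟨h, rfl⟩ | ⟨i, h, rfl⟩)
    · exact Or.inl ⟨(hz.meets_rot _).1 h, mk_turn _ _ _⟩
    · exact Or.inr ⟨i + 1, h, rfl⟩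
  · rintro (⟨h, rfl⟩ | ⟨i, h, rfl⟩)
    · exact Or.inl ⟨(hz.meets_rot _).2 h, (mk_turn _ _ _).symm⟩
    · have : (turn R z)^[i] x = (turn R z)^[i + 2] (turn R z x) := by
        rw [← Function.iterate_succ_apply, Function.iterate_add_apply _ i 3, turn_turn_turn hX]
      exact Or.inr ⟨i + 2, by rwa [← this], mk_congr (by rw [← this]) _ _⟩

theorem At.eq_mk (hz : CellGeometry z) {x : X.Dart × SmallTriangle} {w : Vertex R z}
    (h : At R z x w) (hx : x.2.Meets z) : w = mk R z x hx := by
  rcases h with ⟨h, rfl⟩ | ⟨i, h, rfl⟩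
  · rfl
  · have h1 := (CellGeometry.meets_iterate (R := R) hz x i).2 hx
    rw [mk_cross _ h1, mk_iterate_turn hz _ _ hx]

theorem mod_three_of_not_meets (hX : X.IsRegularOfDegree 3) (hz : CellGeometry z)
    {x y : X.Dart × SmallTriangle} (hx : x.2.Meets z) (hxy : x.2.Adjacent y.2)
    (hy : ¬ y.2.Meets z) (h0 : (cross z y).2.Meets z) {j : ℕ}
    (hj : (cross z ((turn R z)^[j] y)).2.Meets z) : j % 3 = 0 := by
  rw [← iterate_turn_mod hX] at hj
  have : j % 3 < 3 := Nat.mod_lt _ (by norm_num)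
  interval_cases j % 3
  · rfl
  · exact (hz.not_meets_flp_rot _ _ hx hxy hy h0 hj).elim
  · refine (hz.not_meets_flp_rot ((turn R z)^[2] x).2 ((turn R z)^[2] y).2
      ((CellGeometry.meets_iterate hz x 2).2 hx) ((adjacent_iterate 2).2 hxy)
      (fun h => hy ((CellGeometry.meets_iterate hz y 2).1 h)) hj ?_).elim
    have : ((turn R z)^[2] y).2.rot z = y.2 := rot_rot_rot z y.2
    rw [this]
    exact h0

/-- A triangle just outside lies in only one adjacent copy, by `not_meets_flp_rot`, so different
crossings cannot compete. -/
theorem At.unique (hX : X.IsRegularOfDegree 3) (hz : CellGeometry z)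
    {x y : X.Dart × SmallTriangle} (hx : x.2.Meets z) (hxy : x.2.Adjacent y.2)
    {w w' : Vertex R z} (h : At R z y w) (h' : At R z y w') : w = w' := by
  by_cases hy : y.2.Meets z
  · rw [h.eq_mk hz hy, h'.eq_mk hz hy]
  · rcases h with ⟨h, rfl⟩ | ⟨i, h, rfl⟩
    · exact (hy h).elim
    rcases h' with ⟨h', rfl⟩ | ⟨j, h', rfl⟩
    · exact (hy h').elim
    have e : (turn R z)^[j + 2 * i] ((turn R z)^[i] y) = (turn R z)^[j] y := by
      rw [← Function.iterate_add_apply]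
      exact iterate_turn_congr hX y (by omega)
    have hm := mod_three_of_not_meets (R := R) hX hz (x := (turn R z)^[i] x)
      (y := (turn R z)^[i] y) (j := j + 2 * i)
      ((CellGeometry.meets_iterate hz x i).2 hx) ((adjacent_iterate i).2 hxy)
      (fun h => hy ((CellGeometry.meets_iterate hz y i).1 h)) h (by rw [e]; exact h')
    apply mk_congr
    rw [← e, ← iterate_turn_mod hX _ (j + 2 * i), hm, Function.iterate_zero_apply]

theorem At.exists (hz : CellGeometry z) {x y : X.Dart × SmallTriangle} (hx : x.2.Meets z)
    (hxy : x.2.Adjacent y.2) : ∃ w, At R z y w := by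
  rcases hz.meets_of_adjacent _ _ hx hxy with h | h | h | h
  · exact ⟨_, Or.inl ⟨h, rfl⟩⟩
  · exact ⟨_, Or.inr ⟨0, h, rfl⟩⟩
  · exact ⟨_, Or.inr ⟨1, h, rfl⟩⟩
  · exact ⟨_, Or.inr ⟨2, h, rfl⟩⟩

theorem At.cross (hX : X.IsRegularOfDegree 3) (hz : CellGeometry z)
    {x y : X.Dart × SmallTriangle} (hx : x.2.Meets z) (hx' : (cross z x).2.Meets z)
    (hxy : x.2.Adjacent y.2) {w : Vertex R z} (h : At R z y w) : At R z (cross z y) w := by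
  rcases hz.meets_of_adjacent_of_flp _ _ hx hx' hxy with hy | hy
  · refine Or.inr ⟨0, by rw [Function.iterate_zero_apply, cross_cross]; exact hy, ?_⟩
    rw [h.eq_mk hz hy]
    exact mk_congr (cross_cross _ _).symm _ _
  · refine Or.inl ⟨hy, ?_⟩
    exact At.unique hX hz hx hxy h (Or.inr ⟨0, hy, rfl⟩)

/-- This makes the three planar neighbours of a cell distinct from each other and from the cell
after gluing. -/
theorem At.injective (hX : X.IsRegularOfDegree 3) (hz : CellGeometry z)
    {x y y' : X.Dart × SmallTriangle} (hx : x.2.Meets z) (h1 : x.1 = y.1) (h1' : x.1 = y'.1)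
    (hxy : y = x ∨ x.2.Adjacent y.2) (hxy' : y' = x ∨ x.2.Adjacent y'.2)
    {w : Vertex R z} (h : At R z y w) (h' : At R z y' w) : y = y' := by
  have mixed : ∀ y y' : X.Dart × SmallTriangle, y.1 = y'.1 → y.2.Meets z → At R z y w →
      At R z y' w → y = y' := by
    intro y y' h1 hy h h'
    have hw := h.eq_mk hz hy
    rcases h' with ⟨h', rfl⟩ | ⟨i, h', rfl⟩
    · exact eq_of_same hX h1 (same_of_mk_eq hX hz hw.symm)
    · rcases same_of_mk_eq hX hz hw.symm with ⟨j, hj⟩ | ⟨l, j, -, hj⟩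
      · refine (snd_iterate_turn_ne (R := R) (z := z) y' ((turn R z)^[j + 2 * j] y) ?_ i (2 * j)
          ?_).elim
        · rw [← iterate_turn_mod hX, show (j + 2 * j) % 3 = 0 by omega]
          exact h1.symm
        · rw [hj, ← Function.iterate_add_apply, add_comm]
      · exact eq_of_cross_eq hX h1 hj
  by_cases hy : y.2.Meets z
  · exact mixed y y' (h1.symm.trans h1') hy h h'
  by_cases hy' : y'.2.Meets z
  · exact (mixed y' y (h1'.symm.trans h1) hy' h' h).symm
  replace hxy := hxy.resolve_left (fun e => hy (by rwa [e]))
  replace hxy' := hxy'.resolve_left (fun e => hy' (by rwa [e]))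
  have hyy := h1.symm.trans h1'
  rcases h with ⟨h, rfl⟩ | ⟨i, h, rfl⟩
  · exact (hy h).elim
  rcases h' with ⟨h', hw⟩ | ⟨l, h', hw⟩
  · exact (hy' h').elim
  rcases same_of_mk_eq hX hz hw with ⟨j, hj⟩ | ⟨m, j, hm, hj⟩
  · exact eq_of_cross_eq hX hyy hj
  -- Both triangles lie outside and their crossed images differ by another crossing, so cut cells
  -- exist. Then x is itself cut by the side crossed towards y and by that crossed towards y'. No
  -- cell is cut by two sides, so these sides agree.
  · rcases hz.flp_cases with hcut | hcut
    · exact (hcut _ ((CellGeometry.meets_iterate hz _ m).2 h) hm).elim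
    · have c1 : (GoldbergCoxeter.cross z ((turn R z)^[i] x)).2.Meets z :=
        hcut _ ((turn R z)^[i] y).2 ((CellGeometry.meets_iterate hz x i).2 hx)
          ((adjacent_iterate i).2 hxy) (fun h => hy ((CellGeometry.meets_iterate hz y i).1 h)) h
      have c2 : (GoldbergCoxeter.cross z ((turn R z)^[l] x)).2.Meets z :=
        hcut _ ((turn R z)^[l] y').2 ((CellGeometry.meets_iterate hz x l).2 hx)
          ((adjacent_iterate l).2 hxy') (fun h => hy' ((CellGeometry.meets_iterate hz y' l).1 h)) h'
      have e : (turn R z)^[l + 2 * i] ((turn R z)^[i] x) = (turn R z)^[l] x := by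
        rw [← Function.iterate_add_apply]
        exact iterate_turn_congr hX x (by omega)
      have hil := mod_three_of_meets_cross (R := R) hX hz (x := (turn R z)^[i] x)
        ((CellGeometry.meets_iterate hz x i).2 hx) c1 (j := l + 2 * i) (by rw [e]; exact c2)
      have e' : (turn R z)^[l] y' = (turn R z)^[i] y' :=
        iterate_turn_congr hX y' (by omega)
      have hs := eq_of_same hX (x := GoldbergCoxeter.cross z ((turn R z)^[i] y))
        (y := GoldbergCoxeter.cross z ((turn R z)^[l] y'))
        (by rw [e']; simp only [GoldbergCoxeter.cross, iterate_turn, hyy])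
        (same_of_mk_eq hX hz hw)
      exact (eq_of_cross_eq hX hyy.symm (j := 0) hs).symm

end GoldbergCoxeter

/-! ### Adjacency after gluing, and descent of planar functions -/

namespace GoldbergCoxeter

open SmallTriangle

variable {V : Type*} [Fintype V] [DecidableEq V] {X : SimpleGraph V} [DecidableRel X.Adj]
  {R : RotationSystem X} {z : ℤ × ℤ}

/-- The vertex `w` is one of the small triangles of the plane adjacent to `x.2`. -/
def Near (R : RotationSystem X) (z : ℤ × ℤ) (x : X.Dart × SmallTriangle) (w : Vertex R z) : Prop :=
  ∃ s, x.2.Adjacent s ∧ At R z (x.1, s) w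

theorem Near.iterate_turn (hX : X.IsRegularOfDegree 3) (hz : CellGeometry z)
    {x : X.Dart × SmallTriangle} {w : Vertex R z} (i : ℕ) (h : Near R z x w) :
    Near R z ((turn R z)^[i] x) w := by
  induction i with
  | zero => exact h
  | succ i ih =>
    obtain ⟨s, h1, h2⟩ := ih
    rw [Function.iterate_succ_apply']
    refine ⟨s.rot z, (adjacent_rot_iff z).2 h1, ?_⟩
    exact (At.turn_iff hX hz (x := (((turn R z)^[i] x).1, s))).2 h2

theorem Near.cross (hX : X.IsRegularOfDegree 3) (hz : CellGeometry z)
    {x : X.Dart × SmallTriangle} (hx : x.2.Meets z) (hx' : (cross z x).2.Meets z)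
    {w : Vertex R z} (h : Near R z x w) : Near R z (cross z x) w := by
  obtain ⟨s, h1, h2⟩ := h
  refine ⟨s.flp z, (adjacent_flp_iff z).2 h1, ?_⟩
  exact At.cross hX hz (y := (x.1, s)) hx hx' h1 h2

/-- Planar neighbours do not depend on the representative: by the normal form, turns and one
crossing suffice. -/
theorem Near.of_mk_eq (hX : X.IsRegularOfDegree 3) (hz : CellGeometry z)
    {x y : X.Dart × SmallTriangle} {hx : x.2.Meets z} {hy : y.2.Meets z}
    (hxy : mk R z x hx = mk R z y hy) {w : Vertex R z} (h : Near R z x w) : Near R z y w := by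
  rcases same_of_mk_eq hX hz hxy with ⟨i, rfl⟩ | ⟨i, j, hm, rfl⟩
  · exact h.iterate_turn hX hz i
  · exact ((h.iterate_turn hX hz i).cross hX hz
      ((CellGeometry.meets_iterate hz x i).2 hx) hm).iterate_turn hX hz j

theorem Near.of_neighbour (hX : X.IsRegularOfDegree 3) (hz : CellGeometry z)
    {x : X.Dart × SmallTriangle} {hx : x.2.Meets z} {w : Vertex R z}
    (h : Neighbour R z (mk R z x hx) w) : Near R z x w := by
  generalize hv : mk R z x hx = v at h
  rcases h with ⟨d, t, t', h⟩ | ⟨d, t, t', h⟩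
  · exact Near.of_mk_eq hX hz (x := (d, t.1)) (hx := t.2) hv.symm
      ⟨t'.1, h, Or.inl ⟨t'.2, rfl⟩⟩
  · refine Near.of_mk_eq hX hz (x := (d, t.1)) (hx := t.2) hv.symm ⟨t'.1.flp z, ?_, Or.inr
      ⟨0, ?_, ?_⟩⟩
    · rwa [Adjacent, vertices_flp]
    · simpa [GoldbergCoxeter.cross, flp_flp] using t'.2
    · exact mk_congr (x := (d.symm, t'.1)) (by simp [GoldbergCoxeter.cross, flp_flp]) t'.2 _

theorem Near.neighbour (hz : CellGeometry z) {x : X.Dart × SmallTriangle}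
    (hx : x.2.Meets z) {w : Vertex R z} (h : Near R z x w) :
    Neighbour R z (mk R z x hx) w := by
  obtain ⟨s, h1, ⟨h2, rfl⟩ | ⟨i, h2, rfl⟩⟩ := h
  · exact Neighbour.inside x.1 ⟨x.2, hx⟩ ⟨s, h2⟩ h1
  · have hxi := (CellGeometry.meets_iterate (R := R) hz x i).2 hx
    rw [← mk_iterate_turn hz x i hx hxi]
    have h := Neighbour.across (R := R) ((turn R z)^[i] x).1 ⟨_, hxi⟩
      ⟨(GoldbergCoxeter.cross z ((turn R z)^[i] (x.1, s))).2, h2⟩ (by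
        rw [← vertices_flp]
        have := (adjacent_iterate (R := R) (z := z) (x := x) (y := (x.1, s)) i).2 h1
        simpa only [GoldbergCoxeter.cross, flp_flp, Adjacent] using this)
    have e : ((turn R z)^[i] (x.1, s)).1 = ((turn R z)^[i] x).1 := by
      simp only [GoldbergCoxeter.iterate_turn]
    rw [mk_congr (x := GoldbergCoxeter.cross z ((turn R z)^[i] (x.1, s)))
      (y := (((turn R z)^[i] x).1.symm, (GoldbergCoxeter.cross z ((turn R z)^[i] (x.1, s))).2))
      (Prod.ext (by simp only [GoldbergCoxeter.cross, e]) rfl) h2 h2]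
    exact h

theorem graph_adj_iff (hX : X.IsRegularOfDegree 3) {k l : ℤ} (hz : CellGeometry (k, l))
    {x : X.Dart × SmallTriangle} (hx : x.2.Meets (k, l)) {w : Vertex R (k, l)} :
    (graph R k l).Adj (mk R (k, l) x hx) w ↔ Near R (k, l) x w := by
  rw [graph, SimpleGraph.fromRel_adj]
  constructor
  · rintro ⟨-, h | h⟩
    exacts [Near.of_neighbour hX hz h, Near.of_neighbour hX hz h.symm]
  · intro h
    refine ⟨?_, Or.inl (h.neighbour hz hx)⟩
    rintro rfl
    obtain ⟨s, h1, h2⟩ := h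
    have := At.injective hX hz hx (y := x) (y' := (x.1, s)) rfl rfl (Or.inl rfl) (Or.inr h1)
      (Or.inl ⟨hx, rfl⟩) h2
    rw [this] at h1
    exact not_adjacent_self s h1

/-- A function of a dart and a small triangle that is compatible with the identifications of the
Goldberg–Coxeter construction. -/
structure Compatible (R : RotationSystem X) (z : ℤ × ℤ) (F : X.Dart → SmallTriangle → ℂ) :
    Prop where
  next_rot : ∀ d t, F (R.next d) (t.rot z) = F d t
  -- Neighbours s outside the triangle are included: the sum around a cell at the border evaluates F
  -- there.
  symm_flp : ∀ d (t s : SmallTriangle), t.Meets z → (s = t ∨ t.Adjacent s) → (s.flp z).Meets z →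
    F d.symm (s.flp z) = F d s

/-- The function on the vertices of the Goldberg–Coxeter construction given by a compatible
function. -/
def Compatible.lift {F : X.Dart → SmallTriangle → ℂ} (hF : Compatible R z F) :
    Vertex R z → ℂ :=
  Quot.lift (fun x => F x.1 x.2.1) (by
    rintro _ _ (⟨d, t, t', h⟩ | ⟨d, t, t', h⟩)
    · rw [← vertices_rot] at h
      simp only [vertices_injective h, hF.next_rot]
    · rw [← vertices_flp] at h
      have h' := vertices_injective h
      simp only [h']
      exact (hF.symm_flp d t.1 t.1 t.2 (Or.inl rfl) (by rw [← h']; exact t'.2)).symm)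

theorem Compatible.lift_mk {F : X.Dart → SmallTriangle → ℂ} (hF : Compatible R z F)
    (x : X.Dart × SmallTriangle) (h : x.2.Meets z) : hF.lift (GoldbergCoxeter.mk R z x h) = F x.1 x.2 := rfl

theorem Compatible.iterate {F : X.Dart → SmallTriangle → ℂ} (hF : Compatible R z F)
    (x : X.Dart × SmallTriangle) (i : ℕ) :
    F ((turn R z)^[i] x).1 ((turn R z)^[i] x).2 = F x.1 x.2 := by
  induction i with
  | zero => rfl
  | succ i ih => rw [Function.iterate_succ_apply', ← ih]; exact hF.next_rot _ _

theorem Compatible.lift_at {F : X.Dart → SmallTriangle → ℂ} (hF : Compatible R z F)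
    (hz : CellGeometry z) {x y : X.Dart × SmallTriangle} (hx : x.2.Meets z)
    (hxy : x.2.Adjacent y.2) {w : Vertex R z} (h : At R z y w) : hF.lift w = F y.1 y.2 := by
  rcases h with ⟨h, rfl⟩ | ⟨i, h, rfl⟩
  · rfl
  · rw [hF.lift_mk, ← hF.iterate y i]
    exact hF.symm_flp _ _ _ ((CellGeometry.meets_iterate (R := R) hz x i).2 hx)
      (Or.inr ((adjacent_iterate i).2 hxy)) h

theorem Compatible.graphLaplacian_lift (hX : X.IsRegularOfDegree 3) {k l : ℤ}
    (hz : CellGeometry (k, l)) {F : X.Dart → SmallTriangle → ℂ} (hF : Compatible R (k, l) F)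
    {μ : ℂ} (hsum : ∀ d (t : SmallTriangle), t.Meets (k, l) → ∑ i, F d (t.nbr i) = μ * F d t) :
    graphLaplacian (graph R k l) hF.lift = (3 - μ) • hF.lift := by
  funext v
  obtain ⟨x, hx, rfl⟩ := exists_mk_eq v
  choose u hu using fun i => At.exists (R := R) hz (x := x) (y := (x.1, x.2.nbr i)) hx
    (adjacent_iff.2 ⟨i, rfl⟩)
  have hadj : ∀ i, x.2.Adjacent (x.2.nbr i) := fun i => adjacent_iff.2 ⟨i, rfl⟩
  rw [graphLaplacian_apply_of_three _ _ _ u]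
  · simp only [fun i => hF.lift_at hz hx (hadj i) (hu i), hsum _ _ hx, Pi.smul_apply, smul_eq_mul,
      hF.lift_mk x hx]
    ring
  · intro i j hij
    have h2 := hu j
    rw [← hij] at h2
    have := At.injective hX hz hx (y := (x.1, x.2.nbr i)) (y' := (x.1, x.2.nbr j)) rfl rfl
      (Or.inr (hadj i)) (Or.inr (hadj j)) (hu i) h2
    exact nbr_injective _ (congrArg Prod.snd this)
  · intro w
    rw [graph_adj_iff hX hz hx]
    constructor
    · rintro ⟨s, h1, h2⟩
      obtain ⟨i, rfl⟩ := adjacent_iff.1 h1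
      exact ⟨i, At.unique hX hz hx h1 h2 (hu i)⟩
    · rintro ⟨i, rfl⟩
      exact ⟨_, hadj i, hu i⟩

end GoldbergCoxeter

/-! ### Perfect codes in cubic graphs -/

section PerfectCode

variable {V : Type*} [Fintype V] [DecidableEq V] {X : SimpleGraph V} [DecidableRel X.Adj]

theorem CondCii.white_cases {B : Set V} (hB : CondCii X B) (R : RotationSystem X)
    (hX : X.IsRegularOfDegree 3) (d : X.Dart) (hd : d.fst ∉ B) :
    (d.snd ∈ B ∧ (R.next d).snd ∉ B ∧ (R.next (R.next d)).snd ∉ B) ∨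
    (d.snd ∉ B ∧ (R.next d).snd ∈ B ∧ (R.next (R.next d)).snd ∉ B) ∨
    (d.snd ∉ B ∧ (R.next d).snd ∉ B ∧ (R.next (R.next d)).snd ∈ B) := by
  have f1 : (R.next d).fst = d.fst := R.fst_next d
  have f2 : (R.next (R.next d)).fst = d.fst := (R.fst_next _).trans f1
  obtain ⟨q, ⟨hq, hqB⟩, huniq⟩ := hB _ hd
  have key : ∀ d' : X.Dart, d'.fst = d.fst → (d'.snd ∈ B ↔ d'.snd = q) := by
    intro d' h
    refine ⟨fun h' => huniq _ ⟨h ▸ d'.adj, h'⟩, fun h' => h' ▸ hqB⟩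
  have hne : ∀ d₁ d₂ : X.Dart, d₁.fst = d.fst → d₂.fst = d.fst → d₁ ≠ d₂ → d₁.snd = q →
      d₂.snd ≠ q := fun d₁ d₂ h1 h2 h12 h3 h4 =>
    h12 (SimpleGraph.Dart.ext _ _ (Prod.ext (h1.trans h2.symm) (h3.trans h4.symm)))
  have n1 := R.next_ne hX d
  have n2 := R.next_next_ne hX d
  have n3 := R.next_ne hX (R.next d)
  rw [key d rfl, key _ f1, key _ f2]
  rcases R.eq_of_fst_eq hX (d := d) (d' := ⟨(d.fst, q), hq⟩) rfl with h | h | h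
  · have h0 : d.snd = q :=
      (congrArg (fun e : X.Dart => e.snd) h).symm
    exact Or.inl ⟨h0, hne _ _ rfl f1 n1.symm h0, hne _ _ rfl f2 n2.symm h0⟩
  · have h0 : (R.next d).snd = q :=
      (congrArg (fun e : X.Dart => e.snd) h).symm
    exact Or.inr (Or.inl ⟨hne _ _ f1 rfl n1 h0, h0, hne _ _ f1 f2 n3.symm h0⟩)
  · have h0 : (R.next (R.next d)).snd = q :=
      (congrArg (fun e : X.Dart => e.snd) h).symm
    exact Or.inr (Or.inr ⟨hne _ _ f2 rfl n2 h0, hne _ _ f2 f1 n3 h0, h0⟩)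

theorem CondCi.snd_notMem {B : Set V} (hB : CondCi X B) {d : X.Dart} (hd : d.fst ∈ B) :
    d.snd ∉ B := hB _ hd _ d.adj

-- B is a perfect code: each closed neighbourhood has one black and three white vertices, and 3 - 1
-- - 1 - 1 = 0.
open Classical in
theorem closed_neighbourhood_sum {B : Set V} (hB : CondCi X B) (hB' : CondCii X B)
    (R : RotationSystem X) (hX : X.IsRegularOfDegree 3) {f : V → ℂ}
    (hf : f = fun p => if p ∈ B then 3 else -1) (d : X.Dart) :
    f d.fst + f d.snd + f (R.next d).snd + f (R.next (R.next d)).snd = 0 := by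
  subst hf
  have f1 : (R.next d).fst = d.fst := R.fst_next d
  have f2 : (R.next (R.next d)).fst = d.fst := (R.fst_next _).trans f1
  by_cases hd : d.fst ∈ B
  · have h0 := hB.snd_notMem hd
    have h1 := hB.snd_notMem (d := R.next d) (f1 ▸ hd)
    have h2 := hB.snd_notMem (d := R.next (R.next d)) (f2 ▸ hd)
    simp only [hd, h0, h1, h2, if_true, if_false]
    norm_num
  · rcases hB'.white_cases R hX d hd with ⟨h0, h1, h2⟩ | ⟨h0, h1, h2⟩ | ⟨h0, h1, h2⟩ <;>
      simp only [hd, h0, h1, h2, if_true, if_false] <;> norm_num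

theorem CondCii.exists_dart {B : Set V} (hB : CondCi X B) (hB' : CondCii X B)
    (hconn : X.Connected) (hX : X.IsRegularOfDegree 3) :
    ∃ d : X.Dart, d.fst ∉ B ∧ d.snd ∈ B := by
  obtain ⟨p⟩ := hconn.nonempty
  by_cases hp : p ∈ B
  · have h1 : 0 < X.degree p := by rw [hX.degree_eq]; norm_num
    obtain ⟨q, hq⟩ := (X.degree_pos_iff_exists_adj p).1 h1
    exact ⟨⟨(q, p), hq.symm⟩, hB _ hp _ hq, hp⟩
  · obtain ⟨q, ⟨hq, hqB⟩, -⟩ := hB' _ hp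
    exact ⟨⟨(p, q), hq⟩, hp, hqB⟩

end PerfectCode

/-! ### The eigenfunction for odd axis parameters -/

namespace GoldbergCoxeter

open SmallTriangle

variable {V : Type*} {X : SimpleGraph V}

/-- The value of `f` at the initial vertex of `d` or at one of its three neighbours, chosen by the
parities of `a` and `b`. -/
def parityValue (R : RotationSystem X) (f : V → ℂ) (d : X.Dart) (a b : ℤ) : ℂ :=
  if Even a then if Even b then f d.fst else f (R.next d).snd
  else if Even b then f (R.next (R.next d)).snd else f d.snd

/-- The function on small triangles that is periodic modulo `2` and takes, on every closed
neighbourhood, the values of `f` at the initial vertex of `d` and its three neighbours. -/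
def parityExtension (R : RotationSystem X) (f : V → ℂ) (d : X.Dart) : SmallTriangle → ℂ
  | up a b => parityValue R f d a b
  | down a b => parityValue R f d a (b + 1)

variable [Fintype V] [DecidableEq V] [DecidableRel X.Adj]

theorem compatible_parityExtension (R : RotationSystem X) (hX : X.IsRegularOfDegree 3) (f : V → ℂ)
    {k : ℤ} (hk : 0 < k) (hodd : Odd k) : Compatible R (k, 0) (parityExtension R f) where
  next_rot d t := by
    have hk' : ¬ Even k := Int.not_even_iff_odd.2 hodd
    rcases t with ⟨a, b⟩ | ⟨a, b⟩ <;> by_cases ha : Even a <;> by_cases hb : Even b <;>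
      simp [parityExtension, parityValue, rot, -Int.not_even_iff_odd, ← Int.not_even_iff_odd, Int.even_add, Int.even_sub, hk', ha, hb,
        R.next_next_next hX, R.fst_next]
  symm_flp d t s ht hs hm := by
    have hk' : ¬ Even k := Int.not_even_iff_odd.2 hodd
    rcases hs with rfl | hs
    · exfalso
      rcases (cellGeometry_axis hk).flp_cases with h | h
      · exact h _ ht hm
      · rcases s with ⟨a, b⟩ | ⟨a, b⟩ <;>
          simp only [flp, meets_axis_up hk, meets_axis_down hk] at ht hm <;> omega
    · rcases t with ⟨a, b⟩ | ⟨a, b⟩ <;> rcases s with ⟨a', b'⟩ | ⟨a', b'⟩ <;>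
        simp only [flp, meets_axis_up hk, meets_axis_down hk, adjacent_up_down,
          adjacent_down_up, not_adjacent_up_up, not_adjacent_down_down] at ht hs hm
      -- The only case is a crossing of the side from z to ωz. As k is odd, both parities agree
      -- there, so the value is f at an end of d, and the flip exchanges the two ends.
      · obtain rfl : a' = a + 1 := by omega
        obtain rfl : b' = b := by omega
        obtain rfl : k = a + b' + 1 := by omega
        by_cases ha : Even a <;> by_cases hb : Even b' <;>
          simp [Int.even_add, ha, hb] at hk' <;>
          simp [parityExtension, parityValue, flp, Int.even_add, Int.even_sub, ha, hb,
            -Int.not_even_iff_odd, ← Int.not_even_iff_odd]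
      · omega

/-- A small triangle and its three neighbours represent the four parity classes once each. -/
theorem sum_parityExtension (R : RotationSystem X) {f : V → ℂ} {d : X.Dart}
    (hf : f d.fst + f d.snd + f (R.next d).snd + f (R.next (R.next d)).snd = 0)
    (t : SmallTriangle) : ∑ i, parityExtension R f d (t.nbr i) = -1 * parityExtension R f d t := by
  rcases t with ⟨a, b⟩ | ⟨a, b⟩ <;> by_cases ha : Even a <;> by_cases hb : Even b <;>
    simp [Fin.sum_univ_three, nbr, parityExtension, parityValue, -Int.not_even_iff_odd,
      ← Int.not_even_iff_odd, Int.even_add, Int.even_sub, ha,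
      hb] <;> linear_combination hf

theorem hasEigenvalue_four_of_odd (R : RotationSystem X) (hX : X.IsRegularOfDegree 3)
    (hconn : X.Connected) {B : Set V} (hB : CondCi X B) (hB' : CondCii X B) {k : ℤ} (hk : 0 < k)
    (hodd : Odd k) : Module.End.HasEigenvalue (graphLaplacian (graph R k 0)) 4 := by
  classical
  obtain ⟨f, hf⟩ : ∃ f : V → ℂ, f = fun p => if p ∈ B then 3 else -1 := ⟨_, rfl⟩
  have hsum := closed_neighbourhood_sum hB hB' R hX hf
  have hF := compatible_parityExtension R hX f hk hodd
  have hlap := hF.graphLaplacian_lift hX (cellGeometry_axis hk) (μ := -1)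
    fun d t _ => sum_parityExtension R (hsum d) t
  obtain ⟨d, hd, -⟩ := CondCii.exists_dart hB hB' hconn hX
  refine Module.End.hasEigenvalue_of_hasEigenvector (x := hF.lift)
    ⟨Module.End.mem_eigenspace_iff.2 (by rw [hlap]; norm_num), fun h0 => ?_⟩
  have h1 := congrFun h0 (mk R (k, 0) (d, up 0 0) ((meets_axis_up hk).2 (by omega)))
  rw [hF.lift_mk] at h1
  simp [parityExtension, parityValue, hf, hd] at h1

end GoldbergCoxeter

/-! ### Two-colourings of the faces, by linear algebra modulo two -/

namespace RotationSystem

variable {V : Type*} {X : SimpleGraph V}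

/-- The face on the left-hand side of a dart. -/
def leftFace (R : RotationSystem X) (d : X.Dart) : R.Face :=
  Quotient.mk (Equiv.Perm.SameCycle.setoid R.turnLeft) d

theorem leftFace_turnLeft (R : RotationSystem X) (d : X.Dart) :
    R.leftFace (R.turnLeft d) = R.leftFace d :=
  Quotient.sound (s := Equiv.Perm.SameCycle.setoid R.turnLeft)
    (Equiv.Perm.sameCycle_apply_left.2 (Equiv.Perm.SameCycle.refl _ _))

theorem turnLeft_symm_next (R : RotationSystem X) (d : X.Dart) :
    R.turnLeft (R.next d).symm = d := by
  simp [turnLeft, reverse]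

theorem leftFace_symm_next (R : RotationSystem X) (d : X.Dart) :
    R.leftFace (R.next d).symm = R.leftFace d := by
  rw [← R.leftFace_turnLeft, turnLeft_symm_next]

theorem exists_leftFace (R : RotationSystem X) (F : R.Face) : ∃ d, R.leftFace d = F :=
  Quotient.exists_rep F

theorem dart_edge_surjective (e : X.edgeSet) : ∃ d : X.Dart, d.edge = e := by
  obtain ⟨e, he⟩ := e
  induction e with
  | h a b => exact ⟨⟨(a, b), he⟩, rfl⟩

/-- A dart on each edge. -/
noncomputable def edgeDart (e : X.edgeSet) : X.Dart := (dart_edge_surjective e).choose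

theorem edge_edgeDart (e : X.edgeSet) : (edgeDart e).edge = e := (dart_edge_surjective e).choose_spec

/-- A sum over the darts, arranged by edges. -/
theorem sum_edgeDart [Fintype X.Dart] [Fintype X.edgeSet] {M : Type*} [AddCommMonoid M]
    (h : X.Dart → M) :
    ∑ e : X.edgeSet, (h (edgeDart e) + h (edgeDart e).symm) = ∑ d, h d := by
  classical
  have hfib := Finset.sum_fiberwise (s := (Finset.univ : Finset X.Dart))
    (g := fun d => (⟨d.edge, d.edge_mem⟩ : X.edgeSet)) (f := h)
  rw [← hfib]
  refine Finset.sum_congr rfl fun e _ => ?_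
  have : (Finset.univ.filter fun d : X.Dart => (⟨d.edge, d.edge_mem⟩ : X.edgeSet) = e) =
      {edgeDart e, (edgeDart e).symm} := by
    ext d
    rw [Finset.mem_filter, Finset.mem_insert, Finset.mem_singleton, ← SimpleGraph.dart_edge_eq_iff,
      edge_edgeDart, Subtype.ext_iff]
    simp
  rw [this, Finset.sum_pair (edgeDart e).symm_ne.symm]

/-- The coboundary map on the faces modulo two. -/
noncomputable def faceCoboundary (R : RotationSystem X) :
    (R.Face → ZMod 2) →ₗ[ZMod 2] (X.edgeSet → ZMod 2) where
  toFun c e := c (R.leftFace (edgeDart e)) + c (R.leftFace (edgeDart e).symm)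
  map_add' c c' := by ext e; simp only [Pi.add_apply]; ring
  map_smul' r c := by ext e; simp only [Pi.smul_apply, smul_eq_mul, RingHom.id_apply]; ring

/-- The incidence matrix modulo two. -/
noncomputable def incidence (X : SimpleGraph V) [DecidableEq V] : Matrix X.edgeSet V (ZMod 2) :=
  fun e v => (if (edgeDart e).fst = v then 1 else 0) + if (edgeDart e).snd = v then 1 else 0

theorem add_self_zmod_two (a : ZMod 2) : a + a = 0 := CharTwo.add_self_eq_zero a

theorem eq_of_add_eq_zero_zmod_two {a b : ZMod 2} (h : a + b = 0) : a = b := CharTwo.add_eq_zero.1 h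

variable [Fintype V] [DecidableEq V] [DecidableRel X.Adj]

theorem incidence_mulVec (f : V → ZMod 2) (e : X.edgeSet) :
    (incidence X).mulVec f e = f (edgeDart e).fst + f (edgeDart e).snd := by
  simp [Matrix.mulVec, dotProduct, incidence, add_mul, Finset.sum_add_distrib]

theorem incidence_transpose_mulVec (φ : X.edgeSet → ZMod 2) (v : V) :
    (incidence X).transpose.mulVec φ v =
      ∑ d : X.Dart, if d.fst = v then φ ⟨d.edge, d.edge_mem⟩ else 0 := by
  rw [← sum_edgeDart]
  refine Finset.sum_congr rfl fun e _ => ?_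
  have h1 : (⟨(edgeDart e).edge, (edgeDart e).edge_mem⟩ : X.edgeSet) = e :=
    Subtype.ext (edge_edgeDart e)
  have h2 : (⟨(edgeDart e).symm.edge, (edgeDart e).symm.edge_mem⟩ : X.edgeSet) = e :=
    Subtype.ext ((edgeDart e).edge_symm.trans (edge_edgeDart e))
  rw [h1, h2]
  simp [Matrix.transpose, incidence, add_mul]

theorem finrank_le_one_of_const {K ι : Type*} [Field K] (S : Submodule K (ι → K))
    (h : ∀ f ∈ S, ∀ i j, f i = f j) : Module.finrank K S ≤ 1 := by
  have hle : S ≤ Submodule.span K {fun _ => (1 : K)} := by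
    intro f hf
    rw [Submodule.mem_span_singleton]
    by_cases hι : Nonempty ι
    · obtain ⟨i⟩ := hι
      exact ⟨f i, by ext j; simp [h f hf j i]⟩
    · exact ⟨0, by ext j; exact (hι ⟨j⟩).elim⟩
  have hfin : Module.Finite K (Submodule.span K {fun _ : ι => (1 : K)}) :=
    Module.Finite.span_of_finite K (Set.finite_singleton _)
  refine (Submodule.finrank_mono hle).trans ?_
  exact (finrank_span_le_card _).trans (by simp)

theorem eq_of_forall_adj {α : Type*} {f : V → α} (hconn : X.Connected)
    (h : ∀ d : X.Dart, f d.fst = f d.snd) (u v : V) : f u = f v := by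
  obtain ⟨p⟩ := hconn.preconnected u v
  induction p with
  | nil => rfl
  | cons hadj _ ih => exact (h ⟨(_, _), hadj⟩).trans ih

theorem faceCoboundary_edge (R : RotationSystem X) (c : R.Face → ZMod 2) (d : X.Dart) :
    R.faceCoboundary c ⟨d.edge, d.edge_mem⟩ = c (R.leftFace d) + c (R.leftFace d.symm) := by
  have h := edge_edgeDart ⟨d.edge, d.edge_mem⟩
  rcases (SimpleGraph.dart_edge_eq_iff _ _).1 h with h | h
  · simp [faceCoboundary, h]
  · simp only [faceCoboundary, LinearMap.coe_mk, AddHom.coe_mk, h, SimpleGraph.Dart.symm_symm]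
    exact add_comm _ _

theorem finrank_ker_incidence_le (hconn : X.Connected) :
    Module.finrank (ZMod 2) (LinearMap.ker (incidence X).mulVecLin) ≤ 1 := by
  refine finrank_le_one_of_const _ fun f hf => eq_of_forall_adj hconn fun d => ?_
  have h0 := congrFun (LinearMap.mem_ker.1 hf) ⟨d.edge, d.edge_mem⟩
  rw [Matrix.mulVecLin_apply, incidence_mulVec, Pi.zero_apply] at h0
  have h1 := eq_of_add_eq_zero_zmod_two h0
  rcases (SimpleGraph.dart_edge_eq_iff _ _).1 (edge_edgeDart ⟨d.edge, d.edge_mem⟩) with h | h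
  · rwa [h] at h1
  · rw [h] at h1
    exact h1.symm

theorem finrank_ker_faceCoboundary_le (R : RotationSystem X) (hconn : X.Connected) :
    Module.finrank (ZMod 2) (LinearMap.ker R.faceCoboundary) ≤ 1 := by
  refine finrank_le_one_of_const _ fun c hc => ?_
  have hsymm : ∀ d, c (R.leftFace d) = c (R.leftFace d.symm) := by
    intro d
    have h0 := congrFun (LinearMap.mem_ker.1 hc) ⟨d.edge, d.edge_mem⟩
    rw [faceCoboundary_edge] at h0
    exact eq_of_add_eq_zero_zmod_two h0
  have hnext : ∀ d, c (R.leftFace (R.next d)) = c (R.leftFace d) := fun d => by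
    rw [hsymm, leftFace_symm_next]
  have hfst : ∀ d d' : X.Dart, d.fst = d'.fst → c (R.leftFace d) = c (R.leftFace d') := by
    intro d d' h
    obtain ⟨i, rfl⟩ := R.exists_iterate_of_fst_eq h
    induction i with
    | zero => rfl
    | succ i ih =>
      rw [Function.iterate_succ_apply', hnext]
      exact ih (R.fst_iterate_next d i).symm
  intro F F'
  obtain ⟨d, rfl⟩ := R.exists_leftFace F
  obtain ⟨d', rfl⟩ := R.exists_leftFace F'
  classical
  -- All faces around a vertex carry the same value, so c induces a function on the vertices;
  -- connectedness makes it constant.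
  let g : V → ZMod 2 := fun v =>
    if h : ∃ d : X.Dart, d.fst = v then c (R.leftFace h.choose) else 0
  have hg : ∀ d : X.Dart, g d.fst = c (R.leftFace d) := by
    intro d
    have h : ∃ d' : X.Dart, d'.fst = d.fst := ⟨d, rfl⟩
    simp only [g, dif_pos h]
    exact hfst _ _ h.choose_spec
  rw [← hg, ← hg]
  refine eq_of_forall_adj hconn (fun d => ?_) _ _
  rw [hg, hsymm, ← hg]
  rfl

/-- On a plane graph, a set of edges that contains an even number of the edges at every vertex
separates two classes of faces. -/
theorem IsPlane.exists_face_colouring {R : RotationSystem X} (hplane : R.IsPlane)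
    (hconn : X.Connected) (φ : X.edgeSet → ZMod 2)
    (hφ : ∀ v, ∑ d : X.Dart, (if d.fst = v then φ ⟨d.edge, d.edge_mem⟩ else 0) = 0) :
    ∃ c : R.Face → ZMod 2, ∀ d : X.Dart,
      c (R.leftFace d) + c (R.leftFace d.symm) = φ ⟨d.edge, d.edge_mem⟩ := by
  classical
  have : Finite R.Face := Quotient.finite _
  have : Fintype R.Face := Fintype.ofFinite _
  have hrange : LinearMap.range R.faceCoboundary ≤
      LinearMap.ker (incidence X).transpose.mulVecLin := by
    rintro _ ⟨c, rfl⟩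
    rw [LinearMap.mem_ker]
    funext v
    rw [Matrix.mulVecLin_apply, incidence_transpose_mulVec, Pi.zero_apply]
    simp only [faceCoboundary_edge]
    -- Around v each face is met once on the left and once on the right of a dart, so everything
    -- cancels modulo two.
    have h1 : ∑ d : X.Dart, (if d.fst = v then c (R.leftFace d.symm) else 0) =
        ∑ d : X.Dart, if d.fst = v then c (R.leftFace d) else 0 := by
      rw [← Equiv.sum_comp R.next]
      simp only [R.fst_next, R.leftFace_symm_next]
    have h2 : ∀ d : X.Dart, (if d.fst = v then c (R.leftFace d) + c (R.leftFace d.symm) else 0) =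
        (if d.fst = v then c (R.leftFace d) else 0) +
          if d.fst = v then c (R.leftFace d.symm) else 0 := fun d => by split_ifs <;> simp
    simp only [h2, Finset.sum_add_distrib, h1, add_self_zmod_two]
  have e1 := LinearMap.finrank_range_add_finrank_ker R.faceCoboundary
  have e2 := LinearMap.finrank_range_add_finrank_ker (incidence X).mulVecLin
  have e3 := LinearMap.finrank_range_add_finrank_ker (incidence X).transpose.mulVecLin
  have e4 : Module.finrank (ZMod 2) (LinearMap.range (incidence X).transpose.mulVecLin) =
      Module.finrank (ZMod 2) (LinearMap.range (incidence X).mulVecLin) :=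
    Matrix.rank_transpose (incidence X)
  have e5 := finrank_ker_incidence_le hconn
  have e6 := R.finrank_ker_faceCoboundary_le hconn
  have e7 := hplane
  simp only [IsPlane, Nat.card_eq_fintype_card] at e7
  simp only [Module.finrank_fintype_fun_eq_card] at e1 e2 e3
  -- The range has dimension at least F - 1 and the kernel at most E - (V - 1); Euler's relation V -
  -- E + F = 2 forces equality.
  have heq : LinearMap.range R.faceCoboundary =
      LinearMap.ker (incidence X).transpose.mulVecLin :=
    Submodule.eq_of_le_of_finrank_le hrange (by omega)
  have hmem : φ ∈ LinearMap.range R.faceCoboundary := by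
    rw [heq, LinearMap.mem_ker]
    funext v
    rw [Matrix.mulVecLin_apply, incidence_transpose_mulVec, hφ v, Pi.zero_apply]
  obtain ⟨c, hc⟩ := hmem
  exact ⟨c, fun d => by rw [← faceCoboundary_edge, hc]⟩

end RotationSystem

/-! ### Condition (C-iii) and the edges between white vertices -/

section WhiteEdges

variable {V : Type*} [Fintype V] [DecidableEq V] {X : SimpleGraph V} [DecidableRel X.Adj]

/-- Distance one contradicts (C-i), and distance two would give a white vertex two black neighbours.
-/
theorem CondCi.dist_eq_three {B : Set V} (hB : CondCi X B) (hB' : CondCii X B) {x w w' y : V}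
    (hx : x ∈ B) (hy : y ∈ B) (hxy : x ≠ y) (h1 : X.Adj x w) (h2 : X.Adj w w')
    (h3 : X.Adj w' y) : X.dist x y = 3 := by
  have hle : X.dist x y ≤ 3 :=
    X.dist_le (SimpleGraph.Walk.cons h1 (SimpleGraph.Walk.cons h2 (SimpleGraph.Walk.cons h3 .nil)))
  obtain ⟨p, hp⟩ := (h1.reachable.trans (h2.reachable.trans h3.reachable)).exists_walk_length_eq_dist
  rw [← hp] at hle ⊢
  cases p with
  | nil => exact (hxy rfl).elim
  | cons a p =>
    cases p with
    | nil => exact (hB _ hx _ a hy).elim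
    | cons b p =>
      cases p with
      | nil =>
        exact (hxy ((hB' _ (hB _ hx _ a)).unique ⟨a.symm, hx⟩ ⟨b, hy⟩)).elim
      | cons c p =>
        simp only [SimpleGraph.Walk.length_cons] at hle ⊢
        omega

/-- For a perfect code with condition (C-iii) on a plane cubic graph, an edge between two white
vertices lies on the same side of the edges to the black vertices at both of its ends. -/
theorem CondCiii.white_edge {B : Set V} {R : RotationSystem X} (hC : CondCiii R B)
    (hB : CondCi X B) (hB' : CondCii X B) (hconn : X.Connected) (hX : X.IsRegularOfDegree 3)
    (hplane : R.IsPlane) (d : X.Dart) (hd : d.fst ∉ B) (hd' : d.snd ∉ B) :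
    ((R.next d).snd ∈ B → (R.next (R.next d.symm)).snd ∈ B) ∧
      ((R.next (R.next d)).snd ∈ B → (R.next d.symm).snd ∈ B) := by
  classical
  -- The indicator of the white–white edges: two at each white vertex and none at a black one, hence
  -- even everywhere.
  let φ : X.edgeSet → ZMod 2 := fun e => if ∃ x ∈ (e : Sym2 V), x ∈ B then 0 else 1
  have hφ : ∀ d : X.Dart, φ ⟨d.edge, d.edge_mem⟩ = if d.fst ∈ B ∨ d.snd ∈ B then 0 else 1 := by
    intro d
    have : (∃ x ∈ d.edge, x ∈ B) ↔ (d.fst ∈ B ∨ d.snd ∈ B) := by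
      obtain ⟨⟨a, b⟩, h⟩ := d
      change (∃ x ∈ s(a, b), x ∈ B) ↔ _
      simp [Sym2.mem_iff]
    simp only [φ, this]
  obtain ⟨c, hc⟩ := hplane.exists_face_colouring hconn φ (by
    intro v
    obtain ⟨q, hq⟩ := (X.degree_pos_iff_exists_adj v).1 (by rw [hX.degree_eq]; norm_num)
    obtain ⟨d, rfl⟩ : ∃ d : X.Dart, d.fst = v := ⟨⟨(v, q), hq⟩, rfl⟩
    have f1 : (R.next d).fst = d.fst := R.fst_next d
    have f2 : (R.next (R.next d)).fst = d.fst := (R.fst_next _).trans f1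
    have hfilter : (Finset.univ.filter fun e : X.Dart => e.fst = d.fst) =
        {d, R.next d, R.next (R.next d)} := by
      ext e
      simp only [Finset.mem_filter, Finset.mem_univ, true_and, Finset.mem_insert,
        Finset.mem_singleton]
      refine ⟨fun h => R.eq_of_fst_eq hX (d := d) h.symm, ?_⟩
      rintro (rfl | rfl | rfl)
      exacts [rfl, f1, f2]
    rw [← Finset.sum_filter, hfilter, Finset.sum_insert, Finset.sum_pair (R.next_ne hX _).symm,
      hφ, hφ, hφ]
    · by_cases hv : d.fst ∈ B
      · simp [f1, f2, hv]
      · rcases hB'.white_cases R hX d hv with ⟨h0, h1, h2⟩ | ⟨h0, h1, h2⟩ | ⟨h0, h1, h2⟩ <;>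
          simp only [f1, f2, hv, h0, h1, h2, false_or, if_true, if_false, or_false] <;> decide
    · simp only [Finset.mem_insert, Finset.mem_singleton, not_or]
      exact ⟨(R.next_ne hX d).symm, (R.next_next_ne hX d).symm⟩)
  simp only [hφ] at hc
  have hblack : ∀ d : X.Dart, d.fst ∈ B ∨ d.snd ∈ B →
      c (R.leftFace d) = c (R.leftFace d.symm) := by
    intro d h
    have := hc d
    rw [if_pos h] at this
    exact RotationSystem.eq_of_add_eq_zero_zmod_two this
  have hwhite : c (R.leftFace d) ≠ c (R.leftFace d.symm) := by
    intro h
    have := hc d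
    rw [if_neg (not_or.2 ⟨hd, hd'⟩), h, RotationSystem.add_self_zmod_two] at this
    exact absurd this (by decide)
  have hnext : ∀ e : X.Dart, e.fst ∈ B → c (R.leftFace (R.next e)) = c (R.leftFace e) := by
    intro e he
    rw [hblack _ (Or.inl (by rwa [R.fst_next])), R.leftFace_symm_next]
  have hsame : ∀ e e' : X.Dart, e.fst ∈ B → e.fst = e'.fst →
      c (R.leftFace e) = c (R.leftFace e') := by
    intro e e' he h
    rcases R.eq_of_fst_eq hX h with rfl | rfl | rfl
    · rfl
    · rw [hnext e he]
    · rw [hnext _ (by rwa [R.fst_next]), hnext e he]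
  -- A path turning left twice keeps one face on its left, and one turning right twice keeps a face
  -- on its right. The path from (C-iii) may avoid the given white edge; only the colours are
  -- compared.
  have hcolour : ∀ e e' : X.Dart, e.fst ∈ B → e'.fst ∈ B → X.Adj e.snd e'.snd →
      c (R.leftFace e) = c (R.leftFace e') := by
    intro e e' he he' h
    by_cases hxy : e.fst = e'.fst
    · exact hsame _ _ he hxy
    obtain ⟨D, hD, hD' | hD'⟩ := hC _ he _ he'
      (hB.dist_eq_three hB' he he' hxy e.adj h e'.adj.symm)
    · rw [hsame e D he hD.symm, ← R.leftFace_turnLeft D, ← R.leftFace_turnLeft,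
        hblack _ (Or.inr (by rwa [hD']))]
      exact (hsame e' _ he' (hD'.symm : e'.fst = (SimpleGraph.Dart.symm _).fst)).symm
    · have hr : ∀ a : X.Dart, R.leftFace (R.turnRight a).symm = R.leftFace a.symm :=
        fun a => R.leftFace_symm_next a.symm
      rw [hsame e D he hD.symm, hblack D (Or.inl (by rwa [hD])), ← hr D, ← hr]
      exact (hsame e' _ he' (hD'.symm : e'.fst = (SimpleGraph.Dart.symm _).fst)).symm
  have hright : ∀ a : X.Dart, (R.next (R.next a)).snd ∈ B →
      c (R.leftFace a.symm) = c (R.leftFace (R.next (R.next a)).symm) := fun a ha => by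
    rw [← hblack _ (Or.inr ha), ← R.leftFace_symm_next (R.next (R.next a)), R.next_next_next hX]
  have hfst1 : ∀ a : X.Dart, (R.next a).symm.snd = a.fst := fun a => R.fst_next a
  have hfst2 : ∀ a : X.Dart, (R.next (R.next a)).symm.snd = a.fst := fun a =>
    (R.fst_next _).trans (R.fst_next a)
  have hw := hB'.white_cases R hX d.symm hd'
  constructor
  -- Black neighbours on opposite sides of d would have the colours of the two sides of d, which
  -- differ.
  · intro h
    rcases hw with ⟨h0, -, -⟩ | ⟨-, h1, -⟩ | ⟨-, -, h2⟩
    · exact (hd h0).elim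
    · refine (hwhite ?_).elim
      rw [← R.leftFace_symm_next d, ← R.leftFace_symm_next d.symm]
      exact hcolour _ _ h h1 (by rw [hfst1, hfst1]; exact d.adj)
    · exact h2
  · intro h
    rcases hw with ⟨h0, -, -⟩ | ⟨-, h1, -⟩ | ⟨-, -, h2⟩
    · exact (hd h0).elim
    · exact h1
    · refine (hwhite ?_).elim
      rw [hright d h, ← SimpleGraph.Dart.symm_symm d, hright d.symm h2, SimpleGraph.Dart.symm_symm]
      exact hcolour _ _ h2 h (by rw [hfst2, hfst2]; exact d.symm.adj)

end WhiteEdges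

namespace GoldbergCoxeter

open SmallTriangle

/-! ### Standing waves on the triangular lattice -/

/-- `(-1) ^ n`. -/
noncomputable def sgn (n : ℤ) : ℂ := if Even n then 1 else -1

theorem sgn_add (m n : ℤ) : sgn (m + n) = sgn m * sgn n := by
  by_cases hm : Even m <;> by_cases hn : Even n <;> simp [sgn, Int.even_add, hm, hn]

theorem sgn_neg (n : ℤ) : sgn (-n) = sgn n := by simp [sgn]

theorem sgn_one : sgn 1 = -1 := by simp [sgn]

theorem sgn_two_mul (n : ℤ) : sgn (2 * n) = 1 := by simp [sgn]

/-- The superposition of waves that alternate along the lattice lines of the three directions, with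
amplitude `g n` on the lines of height `n`. -/
noncomputable def wave (σ : ℂ) (g : ℤ → ℂ) : SmallTriangle → ℂ
  | up a b => sgn a * g b + sgn (a + b + 1) * g a + sgn b * (σ * g (a + b + 1))
  | down a b => σ * (sgn a * g (b + 1) + sgn (a + b) * g a) + sgn (b + 1) * g (a + b)

/-- Multiplication by `ω` on small triangles. -/
def mulOmega : SmallTriangle → SmallTriangle
  | up a b => down (-b) (a + b)
  | down a b => up (-b - 1) (a + b)

/-- Translation of small triangles. -/
def translate (m n : ℤ) : SmallTriangle → SmallTriangle
  | up a b => up (a + m) (b + n)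
  | down a b => down (a + m) (b + n)

/-- Each term belongs to the line through one side. The neighbour across a side contributes -σ times
the term of that side; each other line occurring bounds two of the neighbours, with opposite signs.
-/
theorem sum_wave {σ : ℂ} (hσ : σ * σ = 1) (g : ℤ → ℂ) (t : SmallTriangle) :
    ∑ i, wave σ g (t.nbr i) = -σ * wave σ g t := by
  rcases t with ⟨a, b⟩ | ⟨a, b⟩
  · simp only [Fin.sum_univ_three, nbr, wave, Matrix.cons_val_zero, Matrix.cons_val_one,
      Matrix.cons_val]
    rw [show b - 1 + 1 = b by ring, show a + 1 + b = a + b + 1 by ring,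
      show a + 1 + (b - 1) = a + b by ring]
    simp only [sgn_add, sgn_one]
    linear_combination (sgn b * g (a + b + 1)) * hσ
  · simp only [Fin.sum_univ_three, nbr, wave, Matrix.cons_val_zero, Matrix.cons_val_one,
      Matrix.cons_val]
    rw [show a - 1 + b + 1 = a + b by ring, show a - 1 + (b + 1) + 1 = a + b + 1 by ring]
    have h1 : sgn (a - 1) = -sgn a := by
      rw [sub_eq_add_neg, sgn_add, sgn_neg, sgn_one]; ring
    simp only [sgn_add, sgn_one, h1]
    linear_combination (sgn a * g (b + 1) + sgn a * sgn b * g a) * hσ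

/-- The rotation permutes the three directions, and the parity of g absorbs the reversed heights. -/
theorem wave_mulOmega {σ : ℂ} (hσ : σ * σ = 1) {g : ℤ → ℂ} (hg : ∀ n, g (-n) = σ * g n)
    (t : SmallTriangle) : wave σ g (mulOmega t) = wave σ g t := by
  rcases t with ⟨a, b⟩ | ⟨a, b⟩
  · simp only [mulOmega, wave]
    rw [show -b + (a + b) = a by ring, hg]
    simp only [sgn_add, sgn_one, sgn_neg]
    linear_combination (sgn a * g b) * hσ
  · simp only [mulOmega, wave]
    rw [show -b - 1 + (a + b) + 1 = a by ring, show -b - 1 = -(b + 1) by ring, hg, sgn_neg]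
    simp only [sgn_add, sgn_one]
    ring

theorem wave_translate {σ : ℂ} {g : ℤ → ℂ} {m n : ℤ} (hm : ∀ i, g (i + 2 * m) = g i)
    (hn : ∀ i, g (i + 2 * n) = g i) (t : SmallTriangle) :
    wave σ g (translate (2 * m) (2 * n) t) = wave σ g t := by
  rcases t with ⟨a, b⟩ | ⟨a, b⟩
  · simp only [translate, wave]
    rw [show a + 2 * m + (b + 2 * n) + 1 = a + b + 1 + 2 * m + 2 * n by ring]
    simp only [hm, hn, sgn_add, sgn_two_mul]
    ring
  · simp only [translate, wave]
    rw [show a + 2 * m + (b + 2 * n) = a + b + 2 * m + 2 * n by ring,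
      show b + 2 * n + 1 = b + 1 + 2 * n by ring]
    simp only [hm, hn, sgn_add, sgn_two_mul]
    ring

/-- Passing between white corners that share the vertex 0 is a rotation by π/3 about 0. -/
theorem mulOmega_rot_flp_rot (z : ℤ × ℤ) (t : SmallTriangle) :
    mulOmega (((t.rot z).flp z).rot z) = t := by
  rcases t with ⟨a, b⟩ | ⟨a, b⟩ <;> simp only [mulOmega, rot, flp, up.injEq, down.injEq] <;> omega

/-- Turning at a black vertex is a rotation of order three about the centre of 0, 2z, 2ωz. -/
theorem translate_mulOmega_flp_rot (z : ℤ × ℤ) (t : SmallTriangle) :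
    translate (2 * z.1) (2 * z.2) (mulOmega (mulOmega ((t.rot z).flp z))) = t.flp z := by
  rcases t with ⟨a, b⟩ | ⟨a, b⟩ <;>
    simp only [translate, mulOmega, rot, flp, up.injEq, down.injEq] <;> omega

/-! ### Transport of the waves to the Goldberg–Coxeter construction -/

section Wave

variable {V : Type*} {X : SimpleGraph V}

open Classical in
/-- The wave `G` on the lattice, transported to the placement along a dart; the triangles of a black
vertex and of its three neighbours are laid out on the triangle `0, 2 z, 2 ω z`. -/
noncomputable def waveExtension (R : RotationSystem X) (z : ℤ × ℤ) (B : Set V)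
    (G : SmallTriangle → ℂ) (d : X.Dart) (t : SmallTriangle) : ℂ :=
  if d.fst ∈ B then G (t.flp z) else if d.snd ∈ B then G t
  else if (R.next d).snd ∈ B then G (t.rot z) else G ((t.rot z).rot z)

variable [Fintype V] [DecidableEq V] [DecidableRel X.Adj]

theorem compatible_waveExtension {R : RotationSystem X} (hX : X.IsRegularOfDegree 3)
    (hconn : X.Connected) (hplane : R.IsPlane) {B : Set V} (hB : CondCi X B) (hB' : CondCii X B)
    (hC : CondCiii R B) {z : ℤ × ℤ} {σ : ℂ} (hσ : σ * σ = 1) {g : ℤ → ℂ}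
    (hg : ∀ n, g (-n) = σ * g n) (h1 : ∀ i, g (i + 2 * z.1) = g i)
    (h2 : ∀ i, g (i + 2 * z.2) = g i) :
    Compatible R z (waveExtension R z B (wave σ g)) := by
  have hrot : ∀ t, wave σ g (((t.rot z).flp z).rot z) = wave σ g t := fun t => by
    conv_rhs => rw [← mulOmega_rot_flp_rot z t, wave_mulOmega hσ hg]
  constructor
  · intro d t
    have f1 : (R.next d).fst = d.fst := R.fst_next d
    by_cases hd : d.fst ∈ B
    · simp only [waveExtension, f1, hd, if_true]
      rw [← translate_mulOmega_flp_rot z t, wave_translate h1 h2, wave_mulOmega hσ hg,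
        wave_mulOmega hσ hg]
    · rcases hB'.white_cases R hX d hd with ⟨a0, a1, a2⟩ | ⟨a0, a1, a2⟩ | ⟨a0, a1, a2⟩ <;>
        simp only [waveExtension, f1, hd, a0, a1, a2, if_true, if_false, rot_rot_rot]
  · intro d _ s _ _ _
    by_cases hd : d.fst ∈ B
    · have hd' := hB.snd_notMem hd
      have e1 : d.symm.fst = d.snd := rfl
      have e2 : d.symm.snd = d.fst := rfl
      simp only [waveExtension, e1, e2, hd, hd', if_true, if_false]
    by_cases hd' : d.snd ∈ B
    · have e1 : d.symm.fst = d.snd := rfl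
      simp only [waveExtension, e1, hd, hd', if_true, if_false, flp_flp]
    obtain ⟨w1, w2⟩ := hC.white_edge hB hB' hconn hX hplane d hd hd'
    have e1 : d.symm.fst = d.snd := rfl
    have e2 : d.symm.snd = d.fst := rfl
    have c1 := hB'.white_cases R hX d hd
    have c2 := hB'.white_cases R hX d.symm hd'
    by_cases h : (R.next d).snd ∈ B
    · have h3 : (R.next d.symm).snd ∉ B := by
        have := w1 h
        tauto
      simp only [waveExtension, e1, e2, hd, hd', h, h3, if_true, if_false]
      rw [← hrot (((s.flp z).rot z).rot z), rot_rot_rot, flp_flp]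
    · have h3 : (R.next d.symm).snd ∈ B := by tauto
      simp only [waveExtension, e1, e2, hd, hd', h, h3, if_true, if_false]
      rw [← hrot ((s.rot z).rot z), rot_rot_rot]

theorem sum_waveExtension (R : RotationSystem X) (z : ℤ × ℤ) (B : Set V) {σ : ℂ}
    (hσ : σ * σ = 1) (g : ℤ → ℂ) (d : X.Dart) (t : SmallTriangle) :
    ∑ i, waveExtension R z B (wave σ g) d (t.nbr i) =
      -σ * waveExtension R z B (wave σ g) d t := by
  have key : ∀ f : SmallTriangle → SmallTriangle, Function.Injective f →
      (∀ s, t.Adjacent s → (f t).Adjacent (f s)) →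
      ∑ i, wave σ g (f (t.nbr i)) = -σ * wave σ g (f t) := by
    intro f hf hadj
    rw [← sum_wave hσ]
    -- A symmetry of the lattice only permutes the order in which the three neighbours are listed.
    choose u hu using fun i => adjacent_iff.1 (hadj _ (adjacent_iff.2 ⟨i, rfl⟩))
    have hinj : Function.Injective u := fun i j hij =>
      nbr_injective t (hf (by rw [hu i, hu j, hij]))
    rw [← (Equiv.ofBijective u (Finite.injective_iff_bijective.1 hinj)).sum_comp
      fun i => wave σ g ((f t).nbr i)]
    exact Finset.sum_congr rfl fun i _ => by rw [hu i]; rfl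
  have hr : Function.Injective (rot z) := fun a b h => by
    rw [← rot_rot_rot z a, h, rot_rot_rot]
  have hf : Function.Injective (flp z) := fun a b h => by rw [← flp_flp z a, h, flp_flp]
  unfold waveExtension
  split_ifs
  · exact key (flp z) hf fun s h => (adjacent_flp_iff z).2 h
  · exact sum_wave hσ g t
  · exact key (rot z) hr fun s h => (adjacent_rot_iff z).2 h
  · exact key (fun s => (s.rot z).rot z) (hr.comp hr) fun s h =>
      (adjacent_rot_iff z).2 ((adjacent_rot_iff z).2 h)

/-- The `2 k`-periodic amplitude concentrated on the heights `j` and `-j`. -/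
noncomputable def amplitude (k : ℤ) (σ : ℂ) (j n : ℤ) : ℂ :=
  (if 2 * k ∣ n - j then 1 else 0) + σ * if 2 * k ∣ n + j then 1 else 0

theorem amplitude_neg {σ : ℂ} (hσ : σ * σ = 1) (k j n : ℤ) :
    amplitude k σ j (-n) = σ * amplitude k σ j n := by
  have h1 : 2 * k ∣ -n - j ↔ 2 * k ∣ n + j := by rw [← dvd_neg]; ring_nf
  have h2 : 2 * k ∣ -n + j ↔ 2 * k ∣ n - j := by rw [← dvd_neg]; ring_nf
  simp only [amplitude, h1, h2]
  linear_combination (-(if 2 * k ∣ n + j then (1 : ℂ) else 0)) * hσ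

theorem amplitude_add (k : ℤ) (σ : ℂ) (j n : ℤ) :
    amplitude k σ j (n + 2 * k) = amplitude k σ j n := by
  have h1 : 2 * k ∣ n + 2 * k - j ↔ 2 * k ∣ n - j := by
    rw [show n + 2 * k - j = n - j + 2 * k by ring, dvd_add_self_right]
  have h2 : 2 * k ∣ n + 2 * k + j ↔ 2 * k ∣ n + j := by
    rw [show n + 2 * k + j = n + j + 2 * k by ring, dvd_add_self_right]
  simp only [amplitude, h1, h2]

/-- The reason for using odd j only: at the test cells two of the three heights are even, so one
term of the wave survives. -/
theorem amplitude_even (k : ℤ) (σ : ℂ) {j n : ℤ} (hj : ¬ Even j) (hn : Even n) :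
    amplitude k σ j n = 0 := by
  have h1 : ¬ 2 * k ∣ n - j := fun h => by
    have := (even_iff_two_dvd.2 ((dvd_mul_right 2 k).trans h))
    simp [Int.even_sub, hn, hj] at this
  have h2 : ¬ 2 * k ∣ n + j := fun h => by
    have := (even_iff_two_dvd.2 ((dvd_mul_right 2 k).trans h))
    simp [Int.even_add, hn, hj] at this
  simp [amplitude, h1, h2]

theorem amplitude_of_ne {k : ℤ} (σ : ℂ) {i j : ℤ} (hi : 0 < i) (hik : i ≤ k) (hj : 0 < j)
    (hjk : j ≤ k) (hij : i ≠ j) : amplitude k σ i j = 0 := by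
  have h1 : ¬ 2 * k ∣ j - i := fun h => by
    have := Int.eq_zero_of_abs_lt_dvd h (by rw [abs_lt]; omega)
    omega
  have h2 : ¬ 2 * k ∣ j + i := fun h => by
    have := Int.le_of_dvd (by omega) h
    omega
  simp [amplitude, h1, h2]

/-- At j = k the heights j and -j coincide modulo 2k and the value is 1 + σ, hence the exclusion for
σ = -1. -/
theorem amplitude_self_ne_zero {k : ℤ} {σ : ℂ} {j : ℤ} (hj : 0 < j)
    (h : σ = 1 ∨ j < k) : amplitude k σ j j ≠ 0 := by
  rcases h with rfl | h
  · by_cases h2 : 2 * k ∣ j + j <;> simp [amplitude, h2]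
  · have h2 : ¬ 2 * k ∣ j + j := fun h => by
      have := Int.le_of_dvd (by omega) h
      omega
    simp [amplitude, h2]

theorem le_multiplicity {R : RotationSystem X} (hX : X.IsRegularOfDegree 3)
    (hconn : X.Connected) (hplane : R.IsPlane) {B : Set V} (hB : CondCi X B) (hB' : CondCii X B)
    (hC : CondCiii R B) {k l : ℤ} (hl : l = 0 ∨ l = k) (hz : CellGeometry (k, l)) {σ : ℂ}
    (hσ : σ * σ = 1) {m : ℕ} (hm : ∀ i < m, 2 * (i : ℤ) + 1 ≤ k ∧ (σ = 1 ∨ 2 * (i : ℤ) + 1 < k))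
    (t : Fin m → SmallTriangle) (ht : ∀ i, (t i).Meets (k, l)) {c : ℂ} (hc : c ≠ 0)
    (hval : ∀ i j : Fin m, wave σ (amplitude k σ (2 * (i : ℤ) + 1)) (t j) =
      c * amplitude k σ (2 * (i : ℤ) + 1) (2 * (j : ℤ) + 1)) :
    m ≤ eigenvalueMultiplicity (graph R k l) (3 + σ) := by
  -- Along a dart from white to black the transported wave is the wave itself, so cells placed there
  -- serve as test points.
  obtain ⟨d, hd, hd'⟩ := CondCii.exists_dart hB hB' hconn hX
  have hF : ∀ i : Fin m, Compatible R (k, l)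
      (waveExtension R (k, l) B (wave σ (amplitude k σ (2 * (i : ℤ) + 1)))) := fun i => by
    refine compatible_waveExtension hX hconn hplane hB hB' hC hσ (amplitude_neg hσ k _)
      (amplitude_add k σ _) ?_
    rcases hl with rfl | rfl
    · intro n
      rw [mul_zero, add_zero]
    · exact amplitude_add l σ _
  have hvals : ∀ i j, (hF i).lift (mk R (k, l) (d, t j) (ht j)) =
      c * amplitude k σ (2 * (i : ℤ) + 1) (2 * (j : ℤ) + 1) := fun i j => by
    rw [Compatible.lift_mk, ← hval]
    simp only [waveExtension, hd, hd', if_true, if_false]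
  refine le_eigenvalueMultiplicity _ _ (fun i => (hF i).lift)
    (fun j => mk R (k, l) (d, t j) (ht j)) (fun i => ?_) (fun i => ?_) fun i j hij => ?_
  · rw [(hF i).graphLaplacian_lift hX hz (fun d t _ => sum_waveExtension R _ B hσ _ d t),
      sub_neg_eq_add]
  · rw [hvals]
    exact mul_ne_zero hc (amplitude_self_ne_zero (by omega) (hm i i.2).2)
  · rw [hvals, amplitude_of_ne σ (by omega) (hm i i.2).1 (by omega) (hm j j.2).1, mul_zero]
    intro h
    exact hij (Fin.ext (by omega))

theorem le_multiplicity_axis_and_diagonal {R : RotationSystem X} (hX : X.IsRegularOfDegree 3)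
    (hconn : X.Connected) (hplane : R.IsPlane) {B : Set V} (hB : CondCi X B) (hB' : CondCii X B)
    (hC : CondCiii R B) {k : ℤ} (hk : 0 < k) {σ : ℂ} (hσ : σ * σ = 1) {m : ℕ}
    (hm : ∀ i < m, 2 * (i : ℤ) + 1 ≤ k ∧ (σ = 1 ∨ 2 * (i : ℤ) + 1 < k)) :
    m ≤ eigenvalueMultiplicity (graph R k 0) (3 + σ) ∧
      m ≤ eigenvalueMultiplicity (graph R k k) (3 + σ) := by
  have hodd : ∀ i : ℕ, ¬ Even (2 * (i : ℤ) + 1) := fun i => by simp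
  constructor
  · refine le_multiplicity hX hconn hplane hB hB' hC (Or.inl rfl) (cellGeometry_axis hk) hσ hm
      (fun j => up (2 * (j : ℤ)) 0) (fun j => ?_) (c := σ) (fun h => by simp [h] at hσ)
      fun i j => ?_
    · have := (hm j j.2).1
      exact (meets_axis_up hk).2 ⟨by omega, le_rfl, by omega⟩
    · simp only [wave]
      rw [amplitude_even k σ (hodd i) Even.zero, amplitude_even k σ (hodd i) (even_two_mul _)]
      simp [sgn]
  · refine le_multiplicity hX hconn hplane hB hB' hC (Or.inr rfl) (cellGeometry_diagonal hk) hσ hm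
      (fun j => up 0 (2 * (j : ℤ) + 1)) (fun j => ?_) (c := 1) one_ne_zero fun i j => ?_
    · have := (hm j j.2).1
      exact (meets_diagonal_up hk).2 ⟨by omega, by omega, by omega⟩
    · simp only [wave]
      rw [amplitude_even k σ (hodd i) Even.zero,
        amplitude_even k σ (hodd i) (n := 0 + (2 * (j : ℤ) + 1) + 1) ⟨j + 1, by ring⟩]
      simp [sgn]

end Wave

end GoldbergCoxeter

/-! ### Eigenvalues 4 (σ = 1) and 2 (σ = -1) -/

theorem proposition4 {V : Type*} [Fintype V] [DecidableEq V] (X : SimpleGraph V)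
    [DecidableRel X.Adj] (hconn : X.Connected) (hcubic : X.IsRegularOfDegree 3)
    (R : RotationSystem X) (hplane : R.IsPlane) :
    ((∃ B : Set V, CondCi X B ∧ CondCii X B) →
      ∀ s : ℕ, 1 ≤ s →
        Module.End.HasEigenvalue (graphLaplacian (GoldbergCoxeter.graph R (2 * (s : ℤ) - 1) 0)) 4) ∧
    ((∃ B : Set V, CondCi X B ∧ CondCii X B ∧ CondCiii R B) →
      ∀ k : ℕ, 1 ≤ k →
        (⌈(k : ℚ) / 2⌉₊ ≤ eigenvalueMultiplicity (GoldbergCoxeter.graph R k 0) 4 ∧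
          ⌊(k : ℚ) / 2⌋₊ ≤ eigenvalueMultiplicity (GoldbergCoxeter.graph R k 0) 2) ∧
        (⌈(k : ℚ) / 2⌉₊ ≤ eigenvalueMultiplicity (GoldbergCoxeter.graph R k k) 4 ∧
          ⌊(k : ℚ) / 2⌋₊ ≤ eigenvalueMultiplicity (GoldbergCoxeter.graph R k k) 2)) := by
  constructor
  · rintro ⟨B, hB, hB'⟩ s hs
    exact GoldbergCoxeter.hasEigenvalue_four_of_odd R hcubic hconn hB hB' (by omega)
      ⟨(s : ℤ) - 1, by ring⟩
  · rintro ⟨B, hB, hB', hC⟩ k hk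
    have hk' : (0 : ℤ) < k := by omega
    obtain ⟨h1, h2⟩ := GoldbergCoxeter.le_multiplicity_axis_and_diagonal hcubic hconn hplane hB hB'
      hC hk' (σ := 1) (by norm_num) (m := ⌈(k : ℚ) / 2⌉₊) (fun i hi => by
        rw [Nat.lt_ceil, lt_div_iff₀ (by norm_num)] at hi
        have : i * 2 < k := by exact_mod_cast hi
        exact ⟨by omega, Or.inl rfl⟩)
    obtain ⟨h3, h4⟩ := GoldbergCoxeter.le_multiplicity_axis_and_diagonal hcubic hconn hplane hB hB'
      hC hk' (σ := -1) (by norm_num) (m := ⌊(k : ℚ) / 2⌋₊) (fun i hi => by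
        -- Below the floor 2 * i + 2 ≤ k, so j = 2 * i + 1 stays strictly below k, as σ = -1
        -- requires.
        have hi := (Nat.le_floor_iff (by positivity)).1 (Nat.succ_le_of_lt hi)
        rw [le_div_iff₀ (by norm_num)] at hi
        have : (i + 1) * 2 ≤ k := by exact_mod_cast hi
        exact ⟨by omega, Or.inr (by omega)⟩)
    norm_num at h1 h2 h3 h4
    exact ⟨⟨by simpa using h1, by simpa using h3⟩, by simpa using h2, by simpa using h4⟩
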